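/- Let $$c_*=16\,\frac{\pi^6-2\pi^4+32\pi^2-32}{(\pi^2+4)^4},\qquad c_{\mathrm{crit}}=\frac{1-\bigl(1-\frac{\sqrt3}{\pi}\bigr)^3}{2},$$ let $M_*$ be the Albeverio–Motovilov function $$M_*(x)=\begin{cases}\frac12\arcsin(\pi x), & 0\le x\le\frac{4}{\pi^2+4},\\[2pt] \frac12\arcsin\bigl(\frac{4\pi}{\pi^2+4}\bigr)+\frac12\arcsin\Bigl(\pi\,\frac{(\pi^2+4)x-4}{\pi^2-4}\Bigr), & \frac{4}{\pi^2+4}<x\le\frac{8\pi^2}{(\pi^2+4)^2},\\[2pt] \arcsin\bigl(\frac{4\pi}{\pi^2+4}\bigr)+\frac12\arcsin\Bigl(\pi\,\frac{(\pi^2+4)^2x-8\pi^2}{(\pi^2-4)^2}\Bigr), & \frac{8\pi^2}{(\pi^2+4)^2}<x\le c_*,\end{cases}$$ and let $$N(x)=\begin{cases}\frac12\arcsin(\pi x), & 0\le x\le\frac{4}{\pi^2+4},\\[2pt] \arcsin\Bigl(\sqrt{\frac{2\pi^2x-4}{\pi^2-4}}\Bigr), & \frac{4}{\pi^2+4}<x<4\,\frac{\pi^2-2}{\pi^4},\\[2pt]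 \arcsin\bigl(\frac{\pi}{2}(1-\sqrt{1-2x})\bigr), & 4\,\frac{\pi^2-2}{\pi^4}\le x\le\kappa,\\[2pt] \frac32\arcsin\bigl(\frac{\pi}{2}(1-\sqrt[3]{1-2x})\bigr), & \kappa<x\le c_{\mathrm{crit}},\end{cases}$$ where $\kappa$ is the solution of $\arcsin\bigl(\frac{\pi}{2}(1-\sqrt{1-2\kappa})\bigr)=\frac32\arcsin\bigl(\frac{\pi}{2}(1-\sqrt[3]{1-2\kappa})\bigr)$ in $\bigl(0,2\frac{\pi-1}{\pi^2}\bigr]$. This solution exists, is unique, and lies in $\bigl(4\frac{\pi^2-2}{\pi^4},2\frac{\pi-1}{\pi^2}\bigr)$. For $\theta\in[0,\frac{\pi}{2}]$ let $D(\theta)$ be the set of finitely supported sequences $\lambda=(\lambda_j)_{j\ge0}$ with $0\le\lambda_j\le\frac1\pi$ for all $j$ and $\sum_{j}\frac12\arcsin(\pi\lambda_j)=\theta$. For such $\lambda$ put $t_0=0$, $t_{j+1}=t_j+\lambda_j(1-2t_j)$ and $\max W(\lambda)=\max_j t_j$, and let $T(\theta)=\sup\{\max W(\lambda)\mid\lambda\in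 D(\theta)\}$. Then: 1. $c_*\in(0,\frac12)$, and $M_*$ maps $[0,c_*]$ into $[0,\frac{\pi}{2}]$. 2. $N(x)=M_*(x)$ for $0\le x\le\frac{4}{\pi^2+4}$. 3. $N(x)<M_*(x)$ for $\frac{4}{\pi^2+4}<x\le c_*$. 4. The function $N\colon[0,c_{\mathrm{crit}}]\to[0,\frac{\pi}{2}]$ is strictly increasing and is the inverse of $T\colon[0,\frac{\pi}{2}]\to[0,c_{\mathrm{crit}}]$. Hence (3) can equivalently be written as $x<T(M_*(x))$; that is, for $\frac{4}{\pi^2+4}<x\le c_*$ one has $$x<T(M_*(x))\le c_{\mathrm{crit}}\qquad\text{and}\qquad N(T(M_*(x)))=M_*(x).$$ 5. In particular, $c_*<c_{\mathrm{crit}}$. -/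

import Mathlib

namespace SubspacePerturbation

noncomputable section

/-- The constant `c_*` of Albeverio and Motovilov. -/
def cStar : ℝ :=
  16 * ((Real.pi ^ 6 - 2 * Real.pi ^ 4 + 32 * Real.pi ^ 2 - 32) / (Real.pi ^ 2 + 4) ^ 4)

/-- The constant `c_crit`. -/
def cCrit : ℝ := (1 - (1 - √3 / Real.pi) ^ 3) / 2

/-- The function `M_*` of Albeverio and Motovilov; it is meant on `[0, c_*]`. -/
def MStar (x : ℝ) : ℝ :=
  if x ≤ 4 / (Real.pi ^ 2 + 4) then
    1 / 2 * Real.arcsin (Real.pi * x)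
  else if x ≤ 8 * Real.pi ^ 2 / (Real.pi ^ 2 + 4) ^ 2 then
    1 / 2 * Real.arcsin (4 * Real.pi / (Real.pi ^ 2 + 4)) +
      1 / 2 * Real.arcsin (Real.pi * (((Real.pi ^ 2 + 4) * x - 4) / (Real.pi ^ 2 - 4)))
  else
    Real.arcsin (4 * Real.pi / (Real.pi ^ 2 + 4)) +
      1 / 2 * Real.arcsin
        (Real.pi * (((Real.pi ^ 2 + 4) ^ 2 * x - 8 * Real.pi ^ 2) / (Real.pi ^ 2 - 4) ^ 2))

/-- `κ` lies in `(0, 2(π-1)/π²]` and solves the equation that determines the switching point of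
the function `N`. -/
def IsKappa (κ : ℝ) : Prop :=
  κ ∈ Set.Ioc 0 (2 * ((Real.pi - 1) / Real.pi ^ 2)) ∧
    Real.arcsin (Real.pi / 2 * (1 - √(1 - 2 * κ))) =
      3 / 2 * Real.arcsin (Real.pi / 2 * (1 - (1 - 2 * κ) ^ (1 / 3 : ℝ)))

/-- The function `N` with switching point `κ`; it is meant on `[0, c_crit]`. -/
def estN (κ x : ℝ) : ℝ :=
  if x ≤ 4 / (Real.pi ^ 2 + 4) then
    1 / 2 * Real.arcsin (Real.pi * x)
  else if x < 4 * ((Real.pi ^ 2 - 2) / Real.pi ^ 4) then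
    Real.arcsin (√((2 * Real.pi ^ 2 * x - 4) / (Real.pi ^ 2 - 4)))
  else if x ≤ κ then
    Real.arcsin (Real.pi / 2 * (1 - √(1 - 2 * x)))
  else
    3 / 2 * Real.arcsin (Real.pi / 2 * (1 - (1 - 2 * x) ^ (1 / 3 : ℝ)))

/-- The set `D` of finitely supported sequences with entries in `[0, 1/π]`. -/
def paramSet : Set (ℕ → ℝ) :=
  {l | ∃ n : ℕ, (∀ j ≤ n, 0 ≤ l j ∧ l j ≤ 1 / Real.pi) ∧ ∀ j, n + 1 ≤ j → l j = 0}

/-- The sequence `W(λ) = (t_j)` with `t_0 = 0` and `t_{j+1} = t_j + λ_j (1 - 2 t_j)`. -/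
def seqW (l : ℕ → ℝ) : ℕ → ℝ
  | 0 => 0
  | j + 1 => seqW l j + l j * (1 - 2 * seqW l j)

/-- The function `M(x) = (1/2) arcsin (π x)`. -/
def rotM (x : ℝ) : ℝ := 1 / 2 * Real.arcsin (Real.pi * x)

/-- The set `D(θ)` of the sequences in `D` with `∑ M(λ_j) = θ`. -/
def constrSet (θ : ℝ) : Set (ℕ → ℝ) :=
  {l | l ∈ paramSet ∧ ∑' j, rotM (l j) = θ}

/-- `max W(λ)`; for `λ ∈ D` the sequence `W(λ)` is bounded and eventually constant, and the
supremum is attained (see `isGreatest_maxW`). -/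
def maxW (l : ℕ → ℝ) : ℝ := ⨆ j, seqW l j

/-- `T(θ) = sup {max W(λ) | λ ∈ D(θ)}`, for `0 ≤ θ ≤ π/2`; this set is then non-empty and bounded
(see `isLUB_optT`). -/
def optT (θ : ℝ) : ℝ := sSup (maxW '' constrSet θ)

theorem paramSet_bounds {l : ℕ → ℝ} (hl : l ∈ paramSet) (j : ℕ) :
    0 ≤ l j ∧ l j < 1 / 2 := by
  obtain ⟨n, h1, h2⟩ := hl
  have hpi := Real.pi_gt_three
  have hlt : 1 / Real.pi < 1 / 2 := one_div_lt_one_div_of_lt (by norm_num) (by linarith)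
  rcases Nat.lt_or_ge n j with h | h
  · rw [h2 j h]; norm_num
  · exact ⟨(h1 j h).1, (h1 j h).2.trans_lt hlt⟩

theorem seqW_bounds {l : ℕ → ℝ} (hl : l ∈ paramSet) (j : ℕ) :
    0 ≤ seqW l j ∧ seqW l j < 1 / 2 := by
  induction j with
  | zero => simp [seqW]
  | succ j ih =>
    have hb := paramSet_bounds hl j
    simp only [seqW]
    constructor <;> nlinarith [ih.1, ih.2, hb.1, hb.2]

theorem isGreatest_maxW {l : ℕ → ℝ} (hl : l ∈ paramSet) :
    IsGreatest (Set.range (seqW l)) (maxW l) := by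
  have hmono : Monotone (seqW l) := by
    refine monotone_nat_of_le_succ fun j => ?_
    have hb := paramSet_bounds hl j
    have ht := seqW_bounds hl j
    simp only [seqW]
    nlinarith [ht.1, ht.2, hb.1, hb.2]
  obtain ⟨n, -, h2⟩ := id hl
  have hconst : ∀ k, seqW l (n + 1 + k) = seqW l (n + 1) := by
    intro k
    induction k with
    | zero => rfl
    | succ k ih =>
      rw [← add_assoc]
      simp only [seqW, h2 (n + 1 + k) (by omega), zero_mul, add_zero] at ih ⊢
      exact ih
  have hg : IsGreatest (Set.range (seqW l)) (seqW l (n + 1)) := by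
    refine ⟨⟨_, rfl⟩, ?_⟩
    rintro _ ⟨j, rfl⟩
    rw [← hconst j]
    exact hmono (by omega)
  have : maxW l = seqW l (n + 1) := hg.csSup_eq
  rwa [this]

theorem constrSet_nonempty {θ : ℝ} (h0 : 0 ≤ θ) (h1 : θ ≤ Real.pi / 2) :
    (constrSet θ).Nonempty := by
  have hpi := Real.pi_pos
  refine ⟨fun j => if j ≤ 1 then Real.sin θ / Real.pi else 0, ⟨1, ?_, ?_⟩, ?_⟩
  · intro j hj
    simp only [hj, if_true]
    have := Real.sin_nonneg_of_nonneg_of_le_pi h0 (by linarith)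
    exact ⟨by positivity, by gcongr; exact Real.sin_le_one θ⟩
  · intro j hj
    have : ¬ j ≤ 1 := by omega
    simp [this]
  · rw [tsum_eq_sum (s := Finset.range 2)]
    · have : Real.pi * (Real.sin θ / Real.pi) = Real.sin θ := by field_simp
      simp only [Finset.sum_range_succ, Finset.sum_range_zero, rotM]
      simp only [zero_le, le_refl, if_true, this, Real.arcsin_sin (by linarith) h1]
      ring
    · intro j hj
      have : ¬ j ≤ 1 := by simp at hj; omega
      simp [rotM, this]

theorem isLUB_optT {θ : ℝ} (h0 : 0 ≤ θ) (h1 : θ ≤ Real.pi / 2) :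
    IsLUB (maxW '' constrSet θ) (optT θ) := by
  refine isLUB_csSup ((constrSet_nonempty h0 h1).image _) ⟨1 / 2, ?_⟩
  rintro _ ⟨l, hl, rfl⟩
  obtain ⟨j, hj⟩ := (isGreatest_maxW hl.1).1
  rw [← hj]
  exact (seqW_bounds hl.1 j).2.le

end

end SubspacePerturbation

namespace SubspacePerturbation

open Real

/-! Put `λ_j = sin x_j / π` with `x_j ∈ [0, π/2]` and `ρ = 2/π`. Then `∑ x_j = 2θ` and `1 - 2 t_n =
∏ gap (x_j)`, so `T(θ)` asks for the smallest product of factors `1 - ρ sin x` when the sum of the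
angles is fixed and at most `π`.

For two angles with half-sum `s` and half-difference `d`, `gap_mul_gap` gives the product `(ρ cos d
- sin s)² + (1 - ρ²) cos² s`. As `s` grows, the best pair is `(2s, 0)`, then a critical pair with
`sin s = ρ cos d`, then `(s, s)`. In an optimal tuple with nothing to merge, all angles but the
smallest therefore agree (`eq_of_optimal_triple`). Along the tuples with `k` equal angles and a
smaller one, convexity of `pathSign` and a few numerical comparisons leave only the ends. So four
angles reduce to three (`quadruple_reduce`), and three to two or to three equal ones
(`triple_reduce`). This yields the closed formula `optT_eq`.

Pairs win up to the unique positive zero of `crossLog`, which corresponds to `κ`; beyond it three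
equal angles win. Inverting each regime gives `N` (`estN_optT`).

Beyond its first branch, `M_*` comes from the angles `(angA, α)` and `(angA, angA, α)`. These are
never optimal: the critical partner of `angA` is `0` (`exists_better_pair`), and the pair `(angA,
angA)` loses to three equal angles. Hence `x < T(M_*(x))`; applying `N` gives `N(x) < M_*(x)`, and
`x = c_*` gives `c_* < c_crit`. -/

/-! ### Products of two factors -/

/-- The constant `2 / π`. -/
noncomputable def rho : ℝ := 2 / π

/-- The factor `1 - 2 λ` for `λ = sin x / π`. -/
noncomputable def gap (x : ℝ) : ℝ := 1 - rho * sin x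

theorem rho_gt : 0.63661 < rho := by
  rw [rho, lt_div_iff₀ pi_pos]
  nlinarith [pi_lt_d6]

theorem rho_lt : rho < 0.63663 := by
  rw [rho, div_lt_iff₀ pi_pos]
  nlinarith [pi_gt_d6]

theorem rho_pos : 0 < rho := by linarith [rho_gt]

theorem rho_lt_one : rho < 1 := by linarith [rho_lt]

theorem rho_sq_lt_one : rho ^ 2 < 1 := by nlinarith [rho_pos, rho_lt_one]

theorem gap_pos (x : ℝ) : 0 < gap x := by
  unfold gap
  nlinarith [sin_le_one x, rho_pos, rho_lt_one]

@[simp] theorem gap_zero : gap 0 = 1 := by simp [gap]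

theorem continuous_gap : Continuous gap := by
  unfold gap
  fun_prop

/-- Completing the square in `cos d`. For a fixed half-sum `s` only the square varies, so the best
pair brings `ρ cos d` as close to `sin s` as possible. -/
theorem gap_mul_gap (a b : ℝ) :
    gap a * gap b = (rho * cos ((a - b) / 2) - sin ((a + b) / 2)) ^ 2 +
      (1 - rho ^ 2) * cos ((a + b) / 2) ^ 2 := by
  have ha : a = (a + b) / 2 + (a - b) / 2 := by ring
  have hb : b = (a + b) / 2 - (a - b) / 2 := by ring
  generalize (a + b) / 2 = s at *
  generalize (a - b) / 2 = d at *
  subst ha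
  rw [hb]
  simp only [gap, sin_add, sin_sub]
  have hs := sin_sq_add_cos_sq s
  have hd := sin_sq_add_cos_sq d
  generalize sin s = x at *
  generalize cos s = y at *
  generalize sin d = z at *
  generalize cos d = w at *
  have hz : z ^ 2 = 1 - w ^ 2 := by linarith
  have hy : y ^ 2 = 1 - x ^ 2 := by linarith
  linear_combination (-rho ^ 2 * y ^ 2) * hz + (-1 + rho ^ 2 * w ^ 2) * hy

theorem cos_half_le {a b : ℝ} (ha : 0 ≤ a) (hb : 0 ≤ b) (h : a + b ≤ 2 * π) :
    cos ((a + b) / 2) ≤ cos ((a - b) / 2) := by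
  rw [← cos_abs ((a - b) / 2)]
  apply cos_le_cos_of_nonneg_of_le_pi (abs_nonneg _) (by linarith)
  rw [abs_le]
  constructor <;> linarith

/-- Two small angles may be merged into one. -/
theorem gap_add_le {a b : ℝ} (ha : 0 ≤ a) (hb : 0 ≤ b) (h : a + b ≤ 2 * π)
    (hs : sin ((a + b) / 2) ≤ rho * cos ((a + b) / 2)) : gap (a + b) ≤ gap a * gap b := by
  -- In the pair `(a + b, 0)` the half-difference equals the half-sum, which makes `cos d` smallest.
  have h0 := gap_mul_gap (a + b) 0
  simp only [gap_zero, mul_one, sub_zero, add_zero] at h0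
  rw [h0, gap_mul_gap a b]
  have := mul_le_mul_of_nonneg_left (cos_half_le ha hb h) rho_pos.le
  gcongr

theorem le_gap_mul_gap (a b : ℝ) :
    (1 - rho ^ 2) * cos ((a + b) / 2) ^ 2 ≤ gap a * gap b := by
  rw [gap_mul_gap]
  nlinarith [sq_nonneg (rho * cos ((a - b) / 2) - sin ((a + b) / 2))]

/-- Two large angles may be replaced by their mean. -/
theorem gap_half_sq_le {a b : ℝ} (hs : rho ≤ sin ((a + b) / 2)) :
    gap ((a + b) / 2) ^ 2 ≤ gap a * gap b := by
  have h0 := gap_mul_gap ((a + b) / 2) ((a + b) / 2)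
  simp only [add_self_div_two, sub_self, zero_div, cos_zero, mul_one] at h0
  rw [sq, h0, gap_mul_gap a b]
  have := mul_le_mul_of_nonneg_left (cos_le_one ((a - b) / 2)) rho_pos.le
  -- Since `sin s ≥ ρ ≥ ρ cos d`, the flipped squares have nonnegative bases.
  rw [sub_sq_comm, sub_sq_comm (rho * _)]
  gcongr
  · linarith

theorem gap_half_sq_lt {a b : ℝ} (hs : rho ≤ sin ((a + b) / 2)) (ha : a ∈ Set.Icc 0 (π / 2))
    (hb : b ∈ Set.Icc 0 (π / 2)) (hab : a ≠ b) :
    gap ((a + b) / 2) ^ 2 < gap a * gap b := by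
  have h0 := gap_mul_gap ((a + b) / 2) ((a + b) / 2)
  simp only [add_self_div_two, sub_self, zero_div, cos_zero, mul_one] at h0
  rw [sq, h0, gap_mul_gap a b]
  have hne : cos ((a - b) / 2) ≠ 1 := by
    intro h
    rw [cos_eq_one_iff_of_lt_of_lt (by linarith [ha.1, hb.2, pi_pos])
      (by linarith [ha.2, hb.1, pi_pos])] at h
    exact hab (by linarith)
  have := mul_lt_mul_of_pos_left (lt_of_le_of_ne (cos_le_one ((a - b) / 2)) hne) rho_pos
  rw [sub_sq_comm, sub_sq_comm (rho * _)]
  gcongr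
  · linarith

/-- In this range `d = arccos (sin s / ρ)` is admissible and makes the square in `gap_mul_gap`
vanish. -/
theorem exists_pair {s : ℝ} (h0 : 0 ≤ s) (h1 : s ≤ π / 2) (h2 : rho * cos s ≤ sin s)
    (h3 : sin s ≤ rho) : ∃ x ∈ Set.Icc 0 (π / 2), ∃ y ∈ Set.Icc 0 (π / 2), x + y = 2 * s ∧
      gap x * gap y = (1 - rho ^ 2) * cos s ^ 2 := by
  have hr := rho_pos
  -- Because `ρ < sin (π/4)`. Together with `d ≤ s` this keeps `s ± d` in `[0, π/2]`.
  have hs4 : s < π / 4 := by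
    by_contra! h
    have := sin_le_sin_of_le_of_le_pi_div_two (by linarith) h1 h
    rw [sin_pi_div_four] at this
    have h5 : 1.41 < √2 := lt_sqrt_of_sq_lt (by norm_num)
    linarith [rho_lt]
  set c := sin s / rho with hc
  have hc1 : c ≤ 1 := by rw [hc, div_le_one hr]; exact h3
  have hcc : cos s ≤ c := by rw [hc, le_div_iff₀ hr]; linarith
  have hcs : 0 ≤ cos s := cos_nonneg_of_mem_Icc ⟨by linarith, h1⟩
  have hcos : cos (arccos c) = c := cos_arccos (by linarith) hc1
  have hd0 := arccos_nonneg c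
  have hds : arccos c ≤ s := by
    rw [← arccos_cos h0 (by linarith)]
    exact arccos_le_arccos hcc
  refine ⟨s + arccos c, ⟨by linarith, by linarith⟩, s - arccos c, ⟨by linarith, by linarith⟩,
    by ring, ?_⟩
  rw [gap_mul_gap]
  have e1 : (s + arccos c - (s - arccos c)) / 2 = arccos c := by ring
  have e2 : (s + arccos c + (s - arccos c)) / 2 = s := by ring
  rw [e1, e2, hcos, hc]
  field_simp
  ring

/-- The critical partner of an angle is unique. -/
theorem crit_unique {a x y : ℝ} (ha : a ∈ Set.Icc 0 (π / 2)) (hx : x ∈ Set.Icc 0 (π / 2))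
    (hy : y ∈ Set.Icc 0 (π / 2)) (h1 : sin ((a + x) / 2) = rho * cos ((a - x) / 2))
    (h2 : sin ((a + y) / 2) = rho * cos ((a - y) / 2)) : x = y := by
  have hpi := pi_pos
  obtain ⟨ha0, ha1⟩ := ha
  obtain ⟨hx0, hx1⟩ := hx
  obtain ⟨hy0, hy1⟩ := hy
  simp only [add_div, sub_div, sin_add, cos_sub] at h1 h2
  have hk : rho * sin (a / 2) < cos (a / 2) := by
    have h3 : sin (a / 2) ≤ cos (a / 2) := by
      rw [← cos_pi_div_two_sub]
      exact cos_le_cos_of_nonneg_of_le_pi (by linarith) (by linarith) (by linarith)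
    have h4 : 0 < cos (a / 2) := cos_pos_of_mem_Ioo ⟨by linarith, by linarith⟩
    have h5 : 0 ≤ sin (a / 2) := sin_nonneg_of_nonneg_of_le_pi (by linarith) (by linarith)
    nlinarith [rho_lt_one, rho_pos]
  -- Criticality is linear in `sin (x/2)` and `cos (x/2)`, and the coefficient `cos (a/2) - ρ sin
  -- (a/2)` of the sine is positive; so `tan (x/2)` is determined.
  have key : sin (x / 2 - y / 2) = 0 := by
    rw [sin_sub]
    have : (cos (a / 2) - rho * sin (a / 2)) *
        (sin (x / 2) * cos (y / 2) - cos (x / 2) * sin (y / 2)) = 0 := by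
      linear_combination cos (y / 2) * h1 - cos (x / 2) * h2
    rcases mul_eq_zero.1 this with h | h
    · linarith
    · exact h
  rw [sin_eq_zero_iff_of_lt_of_lt (by linarith) (by linarith)] at key
  linarith

/-- In a pair that is optimal for its sum, the angles are equal or critical, unless they are
small. -/
theorem eq_or_crit {a b : ℝ} (ha : a ∈ Set.Icc 0 (π / 2)) (hb : b ∈ Set.Icc 0 (π / 2))
    (hmin : ∀ x ∈ Set.Icc 0 (π / 2), ∀ y ∈ Set.Icc 0 (π / 2), x + y = a + b →
      gap a * gap b ≤ gap x * gap y)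
    (hs : rho * cos ((a + b) / 2) ≤ sin ((a + b) / 2)) :
    a = b ∧ rho ≤ sin ((a + b) / 2) ∨ sin ((a + b) / 2) < rho ∧
      sin ((a + b) / 2) = rho * cos ((a - b) / 2) := by
  obtain ⟨ha0, ha1⟩ := id ha
  obtain ⟨hb0, hb1⟩ := id hb
  rcases le_or_gt rho (sin ((a + b) / 2)) with h | h
  · left
    refine ⟨?_, h⟩
    by_contra hab
    have h1 := gap_half_sq_lt h ha hb hab
    have h2 := hmin ((a + b) / 2) ⟨by linarith, by linarith⟩ ((a + b) / 2)
      ⟨by linarith, by linarith⟩ (by ring)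
    rw [sq] at h1
    linarith
  · right
    refine ⟨h, ?_⟩
    obtain ⟨x, hx, y, hy, hxy, he⟩ := exists_pair (s := (a + b) / 2) (by linarith) (by linarith)
      hs h.le
    have h1 := hmin x hx y hy (by linarith)
    rw [he, gap_mul_gap] at h1
    have h2 : (rho * cos ((a - b) / 2) - sin ((a + b) / 2)) ^ 2 = 0 :=
      le_antisymm (by linarith) (sq_nonneg _)
    have := pow_eq_zero_iff (two_ne_zero) |>.1 h2
    linarith

/-- The quantity `sin s - ρ cos d` that decides between pairs also decides the sign of differences
of `relSlope`. -/
theorem cos_mul_gap_sub (a b : ℝ) : cos b * gap a - cos a * gap b =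
    2 * sin ((a - b) / 2) * (sin ((a + b) / 2) - rho * cos ((a - b) / 2)) := by
  have ha : a = (a + b) / 2 + (a - b) / 2 := by ring
  have hb : b = (a + b) / 2 - (a - b) / 2 := by ring
  generalize (a + b) / 2 = s at *
  generalize (a - b) / 2 = d at *
  subst ha
  rw [hb]
  simp only [gap, sin_add, sin_sub, cos_add, cos_sub]
  have hs := sin_sq_add_cos_sq s
  linear_combination (-2 * rho * cos d * sin d) * hs

/-! ### Logarithmic derivatives and monotonicity -/

/-- Up to the factor `-2 / π`, the derivative of `log ∘ gap`. -/
noncomputable def relSlope (x : ℝ) : ℝ := cos x / gap x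

theorem relSlope_sub (a b : ℝ) : relSlope b - relSlope a =
    2 * sin ((a - b) / 2) * (sin ((a + b) / 2) - rho * cos ((a - b) / 2)) / (gap a * gap b) := by
  rw [← cos_mul_gap_sub, relSlope, relSlope]
  have := (gap_pos a).ne'
  have := (gap_pos b).ne'
  field_simp

theorem relSlope_le {a b : ℝ} (h : b ≤ a) (h2 : a - b ≤ 2 * π)
    (hs : sin ((a + b) / 2) ≤ rho * cos ((a - b) / 2)) : relSlope b ≤ relSlope a := by
  have h0 : 0 ≤ sin ((a - b) / 2) := sin_nonneg_of_nonneg_of_le_pi (by linarith) (by linarith)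
  have := relSlope_sub a b
  have h3 : 2 * sin ((a - b) / 2) * (sin ((a + b) / 2) - rho * cos ((a - b) / 2)) /
      (gap a * gap b) ≤ 0 :=
    div_nonpos_of_nonpos_of_nonneg (mul_nonpos_of_nonneg_of_nonpos (by positivity) (by linarith))
      (mul_pos (gap_pos a) (gap_pos b)).le
  linarith

theorem relSlope_ge {a b : ℝ} (h : b ≤ a) (h2 : a - b ≤ 2 * π)
    (hs : rho * cos ((a - b) / 2) ≤ sin ((a + b) / 2)) : relSlope a ≤ relSlope b := by
  have h0 : 0 ≤ sin ((a - b) / 2) := sin_nonneg_of_nonneg_of_le_pi (by linarith) (by linarith)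
  have := relSlope_sub a b
  have h3 : 0 ≤ 2 * sin ((a - b) / 2) * (sin ((a + b) / 2) - rho * cos ((a - b) / 2)) /
      (gap a * gap b) :=
    div_nonneg (mul_nonneg (by positivity) (by linarith)) (mul_pos (gap_pos a) (gap_pos b)).le
  linarith

theorem relSlope_lt {a b : ℝ} (h : b < a) (h2 : a - b < 2 * π)
    (hs : sin ((a + b) / 2) < rho * cos ((a - b) / 2)) : relSlope b < relSlope a := by
  have h0 : 0 < sin ((a - b) / 2) := sin_pos_of_pos_of_lt_pi (by linarith) (by linarith)
  have := relSlope_sub a b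
  have h3 : 2 * sin ((a - b) / 2) * (sin ((a + b) / 2) - rho * cos ((a - b) / 2)) /
      (gap a * gap b) < 0 :=
    div_neg_of_neg_of_pos (mul_neg_of_pos_of_neg (by positivity) (by linarith))
      (mul_pos (gap_pos a) (gap_pos b))
  linarith

theorem relSlope_gt {a b : ℝ} (h : b < a) (h2 : a - b < 2 * π)
    (hs : rho * cos ((a - b) / 2) < sin ((a + b) / 2)) : relSlope a < relSlope b := by
  have h0 : 0 < sin ((a - b) / 2) := sin_pos_of_pos_of_lt_pi (by linarith) (by linarith)
  have := relSlope_sub a b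
  have h3 : 0 < 2 * sin ((a - b) / 2) * (sin ((a + b) / 2) - rho * cos ((a - b) / 2)) /
      (gap a * gap b) :=
    div_pos (mul_pos (by positivity) (by linarith)) (mul_pos (gap_pos a) (gap_pos b))
  linarith

theorem relSlope_anti {a b : ℝ} (h : b ≤ a) (hb : rho ≤ sin b) (hb0 : 0 ≤ b) (ha : a ≤ π / 2) :
    relSlope a ≤ relSlope b := by
  refine relSlope_ge h (by linarith [pi_pos]) ?_
  have h1 : sin b ≤ sin ((a + b) / 2) :=
    sin_le_sin_of_le_of_le_pi_div_two (by linarith [pi_pos]) (by linarith) (by linarith)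
  nlinarith [cos_le_one ((a - b) / 2), rho_pos]

/-- The logarithm of `gap`. -/
noncomputable def logGap (x : ℝ) : ℝ := log (gap x)

theorem hasDerivAt_logGap (x : ℝ) : HasDerivAt logGap (-(rho * relSlope x)) x := by
  have h : HasDerivAt gap (-(rho * cos x)) x := by
    exact ((hasDerivAt_sin x).const_mul rho).const_sub 1
  refine (h.log (gap_pos x).ne').congr_deriv ?_
  rw [relSlope]
  ring

@[simp] theorem logGap_zero : logGap 0 = 0 := by simp [logGap]

theorem monotoneOn_of_hasDerivAt {f f' : ℝ → ℝ} {u v : ℝ} (h : ∀ x, HasDerivAt f (f' x) x)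
    (h' : ∀ x ∈ Set.Ioo u v, 0 ≤ f' x) : MonotoneOn f (Set.Icc u v) :=
  monotoneOn_of_deriv_nonneg (convex_Icc u v)
    (fun x _ => (h x).continuousAt.continuousWithinAt)
    (fun x _ => (h x).differentiableAt.differentiableWithinAt)
    (fun x hx => by rw [interior_Icc] at hx; rw [(h x).deriv]; exact h' x hx)

theorem antitoneOn_of_hasDerivAt {f f' : ℝ → ℝ} {u v : ℝ} (h : ∀ x, HasDerivAt f (f' x) x)
    (h' : ∀ x ∈ Set.Ioo u v, f' x ≤ 0) : AntitoneOn f (Set.Icc u v) :=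
  antitoneOn_of_deriv_nonpos (convex_Icc u v)
    (fun x _ => (h x).continuousAt.continuousWithinAt)
    (fun x _ => (h x).differentiableAt.differentiableWithinAt)
    (fun x hx => by rw [interior_Icc] at hx; rw [(h x).deriv]; exact h' x hx)

theorem strictMonoOn_of_hasDerivAt {f f' : ℝ → ℝ} {u v : ℝ} (h : ∀ x, HasDerivAt f (f' x) x)
    (h' : ∀ x ∈ Set.Ioo u v, 0 < f' x) : StrictMonoOn f (Set.Icc u v) :=
  strictMonoOn_of_deriv_pos (convex_Icc u v)
    (fun x _ => (h x).continuousAt.continuousWithinAt)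
    (fun x hx => by rw [interior_Icc] at hx; rw [(h x).deriv]; exact h' x hx)

theorem strictAntiOn_of_hasDerivAt {f f' : ℝ → ℝ} {u v : ℝ} (h : ∀ x, HasDerivAt f (f' x) x)
    (h' : ∀ x ∈ Set.Ioo u v, f' x < 0) : StrictAntiOn f (Set.Icc u v) :=
  strictAntiOn_of_deriv_neg (convex_Icc u v)
    (fun x _ => (h x).continuousAt.continuousWithinAt)
    (fun x hx => by rw [interior_Icc] at hx; rw [(h x).deriv]; exact h' x hx)

/-! ### Paths of `k` equal angles and one smaller angle -/

/-- The logarithm of the product for `k` equal angles and one angle `b` with total `S`. -/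
noncomputable def pathLog (k S b : ℝ) : ℝ := k * logGap ((S - b) / k) + logGap b

theorem hasDerivAt_pathLog {k : ℝ} (hk : k ≠ 0) (S b : ℝ) :
    HasDerivAt (pathLog k S) (rho * (relSlope ((S - b) / k) - relSlope b)) b := by
  have h1 : HasDerivAt (fun b : ℝ => (S - b) / k) (-1 / k) b :=
    ((hasDerivAt_id b).const_sub S).div_const k
  have h2 := (((hasDerivAt_logGap ((S - b) / k)).comp b h1).const_mul k).add (hasDerivAt_logGap b)
  refine h2.congr_deriv ?_
  field_simp
  ring

/-- The sign of the derivative of `pathLog` is opposite to the sign of this function. -/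
noncomputable def pathSign (k S b : ℝ) : ℝ :=
  sin (((S - b) / k + b) / 2) - rho * cos (((S - b) / k - b) / 2)

/-- With `m = 1/k` the second derivative is `(ρ (1 + m)² cos d - (1 - m)² sin s) / 4`. For `k ≤ 3`
one has `1 + m ≥ 2 (1 - m)`, and `4 ρ cos d ≥ 1` because `S ≤ π` keeps `d ≤ π/4`. -/
theorem convexOn_pathSign {k S : ℝ} (hk2 : 2 ≤ k) (hk3 : k ≤ 3) (hS : S ≤ π) :
    ConvexOn ℝ (Set.Icc 0 (S / (k + 1))) (pathSign k S) := by
  have hk : k ≠ 0 := by linarith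
  have hs (b : ℝ) : HasDerivAt (fun b : ℝ => ((S - b) / k + b) / 2) ((-1 / k + 1) / 2) b :=
    ((((hasDerivAt_id b).const_sub S).div_const k).add (hasDerivAt_id b)).div_const 2
  have hd (b : ℝ) : HasDerivAt (fun b : ℝ => ((S - b) / k - b) / 2) ((-1 / k - 1) / 2) b :=
    ((((hasDerivAt_id b).const_sub S).div_const k).sub (hasDerivAt_id b)).div_const 2
  have h1 (b : ℝ) : HasDerivAt (pathSign k S)
      (cos (((S - b) / k + b) / 2) * ((-1 / k + 1) / 2) -
        rho * (-sin (((S - b) / k - b) / 2) * ((-1 / k - 1) / 2))) b :=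
    (hs b).sin.sub ((hd b).cos.const_mul rho)
  have h2 (b : ℝ) : HasDerivAt (fun b => cos (((S - b) / k + b) / 2) * ((-1 / k + 1) / 2) -
        rho * (-sin (((S - b) / k - b) / 2) * ((-1 / k - 1) / 2)))
      (-sin (((S - b) / k + b) / 2) * ((-1 / k + 1) / 2) * ((-1 / k + 1) / 2) -
        rho * (-(cos (((S - b) / k - b) / 2) * ((-1 / k - 1) / 2)) * ((-1 / k - 1) / 2))) b :=
    ((hs b).cos.mul_const _).sub (((hd b).sin.neg.mul_const _).const_mul rho)
  refine convexOn_of_hasDerivWithinAt2_nonneg (convex_Icc _ _)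
    (fun b _ => (h1 b).continuousAt.continuousWithinAt)
    (fun b _ => (h1 b).hasDerivWithinAt) (fun b _ => (h2 b).hasDerivWithinAt) ?_
  intro b hb
  rw [interior_Icc, Set.mem_Ioo, lt_div_iff₀ (by linarith)] at hb
  obtain ⟨hb0, hb1⟩ := hb
  have hd1 : b ≤ (S - b) / k := by rw [le_div_iff₀ (by linarith)]; linarith
  have hd2 : (S - b) / k ≤ π / 2 := by
    rw [div_le_iff₀ (by linarith)]; nlinarith [pi_pos]
  have hc : 0.7 ≤ cos (((S - b) / k - b) / 2) := by
    have h3 : cos (π / 4) ≤ cos (((S - b) / k - b) / 2) :=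
      cos_le_cos_of_nonneg_of_le_pi (by linarith) (by linarith [pi_pos]) (by linarith)
    rw [cos_pi_div_four] at h3
    have h5 : 1.4 < √2 := lt_sqrt_of_sq_lt (by norm_num)
    linarith
  have hm1 : 1 / 3 ≤ 1 / k := one_div_le_one_div_of_le (by linarith) hk3
  have hm2 : 1 / k ≤ 1 / 2 := one_div_le_one_div_of_le (by norm_num) hk2
  have e : -1 / k = -(1 / k) := by ring
  rw [e]
  have hs1 := sin_le_one (((S - b) / k + b) / 2)
  generalize 1 / k = m at *
  generalize sin (((S - b) / k + b) / 2) = x at *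
  generalize cos (((S - b) / k - b) / 2) = y at *
  have h4 : 1 ≤ 4 * rho * y := by nlinarith [rho_gt]
  have h5 : (1 - m) ^ 2 * 4 ≤ (1 + m) ^ 2 := by nlinarith
  have h6 : x * (1 - m) ^ 2 ≤ 1 * (1 - m) ^ 2 := by gcongr
  have h7 : (1 - m) ^ 2 * 4 * (rho * y) ≤ (1 + m) ^ 2 * (rho * y) := by
    apply mul_le_mul_of_nonneg_right h5
    linarith
  nlinarith [mul_nonneg (sq_nonneg (1 - m)) (sub_nonneg.2 h4)]

theorem pathLog_end_le {k S b : ℝ} (hk2 : 2 ≤ k) (hS : S ≤ π) (hb0 : 0 ≤ b)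
    (hb : b ≤ S / (k + 1)) (h : ∀ x ∈ Set.Icc b (S / (k + 1)), 0 ≤ pathSign k S x) :
    (k + 1) * logGap (S / (k + 1)) ≤ pathLog k S b := by
  have hk : k ≠ 0 := by linarith
  have hend : pathLog k S (S / (k + 1)) = (k + 1) * logGap (S / (k + 1)) := by
    have hk1 : k + 1 ≠ 0 := by linarith
    have : (S - S / (k + 1)) / k = S / (k + 1) := by field_simp; ring
    rw [pathLog, this]
    ring
  rw [← hend]
  refine antitoneOn_of_hasDerivAt (hasDerivAt_pathLog hk S) ?_ ⟨le_rfl, hb⟩ ⟨hb, le_rfl⟩ hb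
  intro x hx
  have hx2 := hx.2
  rw [lt_div_iff₀ (by linarith)] at hx2
  have hd1 : x ≤ (S - x) / k := by rw [le_div_iff₀ (by linarith)]; linarith
  have hd2 : (S - x) / k ≤ π := by rw [div_le_iff₀ (by linarith)]; nlinarith [pi_pos, hx.1]
  have := relSlope_ge hd1 (by linarith [hx.1, pi_pos])
    (by have := h x ⟨hx.1.le, hx.2.le⟩; rw [pathSign] at this; linarith)
  exact mul_nonpos_of_nonneg_of_nonpos rho_pos.le (by linarith)

theorem pathLog_start_le {k S b : ℝ} (hk2 : 2 ≤ k) (hS : S ≤ π) (hb0 : 0 ≤ b)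
    (hb : b ≤ S / (k + 1)) (h : ∀ x ∈ Set.Icc 0 b, pathSign k S x ≤ 0) :
    k * logGap (S / k) ≤ pathLog k S b := by
  have hk : k ≠ 0 := by linarith
  have hstart : pathLog k S 0 = k * logGap (S / k) := by simp [pathLog]
  rw [← hstart]
  refine monotoneOn_of_hasDerivAt (hasDerivAt_pathLog hk S) ?_ ⟨le_rfl, hb0⟩ ⟨hb0, le_rfl⟩ hb0
  intro x hx
  have hx2 := hx.2.trans_le hb
  rw [lt_div_iff₀ (by linarith)] at hx2
  have hd1 : x ≤ (S - x) / k := by rw [le_div_iff₀ (by linarith)]; linarith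
  have hd2 : (S - x) / k ≤ π := by rw [div_le_iff₀ (by linarith)]; nlinarith [pi_pos, hx.1]
  have := relSlope_le hd1 (by linarith [hx.1, pi_pos])
    (by have := h x ⟨hx.1.le, hx.2.le⟩; rw [pathSign] at this; linarith)
  exact mul_nonneg rho_pos.le (by linarith)

/-- Along the path the product is minimal at an end, if the path starts with a critical or smaller
pair. -/
theorem pathLog_ends {k S b : ℝ} (hk2 : 2 ≤ k) (hk3 : k ≤ 3) (hS : S ≤ π) (hb0 : 0 ≤ b)
    (hb : b ≤ S / (k + 1)) (h0 : pathSign k S 0 ≤ 0) :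
    k * logGap (S / k) ≤ pathLog k S b ∨
      (k + 1) * logGap (S / (k + 1)) ≤ pathLog k S b := by
  have hc := convexOn_pathSign hk2 hk3 hS
  have hS0 : 0 ≤ S / (k + 1) := hb0.trans hb
  -- A convex function that is nonpositive at `0` can only change sign upwards. So the product rises
  -- and then falls, and the sign at `b` tells which end lies below.
  rcases le_or_gt (pathSign k S b) 0 with h | h
  · left
    refine pathLog_start_le hk2 hS hb0 hb fun x hx => ?_
    exact (hc.le_max_of_mem_Icc ⟨le_rfl, hS0⟩ ⟨hb0, hb⟩ hx).trans (max_le h0 h)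
  · right
    refine pathLog_end_le hk2 hS hb0 hb fun x hx => ?_
    by_contra! hx0
    have := hc.le_max_of_mem_Icc ⟨le_rfl, hS0⟩ ⟨hb0.trans hx.1, hx.2⟩ ⟨hb0, hx.1⟩
    have := this.trans (max_le h0 hx0.le)
    linarith

/-! ### The merging threshold and numerical bounds -/

/-- The angle `2 arctan (2 / π)`. -/
noncomputable def angA : ℝ := 2 * arctan rho

theorem angA_half : angA / 2 = arctan rho := by rw [angA]; ring

theorem cos_angA_half_pos : 0 < cos (angA / 2) := by rw [angA_half]; exact cos_arctan_pos rho

theorem sin_angA_half : sin (angA / 2) = rho * cos (angA / 2) := by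
  have h := tan_arctan rho
  have h2 := cos_angA_half_pos
  rw [angA_half] at *
  rw [tan_eq_sin_div_cos, div_eq_iff h2.ne'] at h
  exact h

theorem cos_sq_angA_half : cos (angA / 2) ^ 2 = 1 / (1 + rho ^ 2) := by
  rw [angA_half, cos_sq_arctan]

theorem sin_angA : sin angA = 2 * rho / (1 + rho ^ 2) := by
  have e : angA = 2 * (angA / 2) := by ring
  rw [e, sin_two_mul, sin_angA_half]
  have := cos_sq_angA_half
  linear_combination 2 * rho * this

theorem cos_angA : cos angA = (1 - rho ^ 2) / (1 + rho ^ 2) := by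
  have e : angA = 2 * (angA / 2) := by ring
  rw [e, cos_two_mul, cos_sq_angA_half]
  have : 1 + rho ^ 2 ≠ 0 := by positivity
  field_simp
  ring

theorem angA_pos : 0 < angA := by
  have := arctan_pos.2 rho_pos
  rw [angA]
  linarith

theorem angA_lt : angA < π / 2 := by
  have h := arctan_strictMono rho_lt_one
  rw [arctan_one] at h
  rw [angA]
  linarith

theorem sin_sub_angA_half (s : ℝ) :
    sin (s - angA / 2) = (sin s - rho * cos s) * cos (angA / 2) := by
  rw [sin_sub, sin_angA_half]
  ring

/-- Turns the hypothesis of `gap_add_le` into `a + b ≤ angA`. -/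
theorem sin_le_iff {s : ℝ} (h0 : 0 ≤ s) (h1 : s ≤ π / 2) :
    sin s ≤ rho * cos s ↔ s ≤ angA / 2 := by
  have hA0 := angA_pos
  have hA1 := angA_lt
  have hpi := pi_pos
  have hc := cos_angA_half_pos
  have hs := sin_sub_angA_half s
  constructor
  · intro h
    by_contra! h2
    have := sin_pos_of_pos_of_lt_pi (x := s - angA / 2) (by linarith) (by linarith)
    nlinarith
  · intro h
    have := sin_nonpos_of_nonpos_of_neg_pi_le (x := s - angA / 2) (by linarith) (by linarith)
    by_contra! h2
    nlinarith

theorem rho_sq_gt : 0.40527 < rho ^ 2 := by nlinarith [rho_gt]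

theorem rho_sq_lt : rho ^ 2 < 0.4053 := by nlinarith [rho_lt, rho_pos]

theorem sin_angA_bounds : 0.906 < sin angA ∧ sin angA < 0.9061 := by
  rw [sin_angA, lt_div_iff₀ (by positivity), div_lt_iff₀ (by positivity)]
  constructor <;> nlinarith [rho_sq_gt, rho_sq_lt, rho_gt, rho_lt]

theorem cos_angA_bounds : 0.4231 < cos angA ∧ cos angA < 0.42323 := by
  rw [cos_angA, lt_div_iff₀ (by positivity), div_lt_iff₀ (by positivity)]
  constructor <;> nlinarith [rho_sq_gt, rho_sq_lt]

theorem angA_gt : π / 3 < angA := by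
  by_contra! h
  have := sin_le_sin_of_le_of_le_pi_div_two (by linarith [angA_pos, pi_pos])
    (by linarith [pi_pos]) h
  rw [sin_pi_div_three] at this
  have h3 : √3 < 1.8 := (sqrt_lt' (by norm_num)).2 (by norm_num)
  linarith [sin_angA_bounds.1]

theorem sin_two_thirds_angA : 0.6858 < sin (2 * angA / 3) := by
  have h3 := sin_three_mul (2 * angA / 3)
  have e : 3 * (2 * angA / 3) = 2 * angA := by ring
  rw [e, sin_two_mul] at h3
  have hA := angA_gt
  have h6 : 1 / 2 ≤ sin (2 * angA / 3) := by
    rw [← sin_pi_div_six]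
    exact sin_le_sin_of_le_of_le_pi_div_two (by linarith [pi_pos])
      (by linarith [pi_pos, angA_lt]) (by linarith [pi_pos])
  have hs : 2 * sin angA * cos angA < 0.767 := by
    nlinarith [sin_angA_bounds.1, sin_angA_bounds.2, cos_angA_bounds.1, cos_angA_bounds.2]
  -- On `[1/2, 0.6858]` the cubic `3y - 4y³` decreases, and at `0.6858` it still exceeds `0.767`.
  by_contra! h
  generalize sin (2 * angA / 3) = y at *
  nlinarith [mul_nonneg (sub_nonneg.2 h6) (sub_nonneg.2 h),
    mul_nonneg (mul_nonneg (sub_nonneg.2 h6) (sub_nonneg.2 h)) (by linarith : (0 : ℝ) ≤ y)]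

theorem rho_lt_sin_two_thirds_angA : rho < sin (2 * angA / 3) := by
  linarith [sin_two_thirds_angA, rho_lt]

/-- Both sides are close to `0.179`; this thin margin dictates the precision of the preceding
bounds. -/
theorem gap_two_thirds_angA : gap (2 * angA / 3) ^ 3 < gap angA ^ 2 := by
  have h1 : gap (2 * angA / 3) < 0.56342 := by
    unfold gap
    nlinarith [sin_two_thirds_angA, rho_gt]
  have h2 : 0.42314 < gap angA := by
    unfold gap
    nlinarith [sin_angA_bounds.2, rho_lt, rho_pos]
  calc gap (2 * angA / 3) ^ 3 < 0.56342 ^ 3 := by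
        gcongr
        exact (gap_pos _).le
    _ < 0.42314 ^ 2 := by norm_num
    _ < gap angA ^ 2 := by gcongr

theorem gap_pi_div_three : gap (π / 3) ^ 3 < gap (π / 4) ^ 4 := by
  have h1 : gap (π / 3) < 0.45 := by
    have : 1.73 < √3 := lt_sqrt_of_sq_lt (by norm_num)
    unfold gap
    rw [sin_pi_div_three]
    nlinarith [rho_gt]
  have h2 : 0.5497 < gap (π / 4) := by
    have : √2 < 1.4144 := (sqrt_lt' (by norm_num)).2 (by norm_num)
    unfold gap
    rw [sin_pi_div_four]
    have : rho * √2 ≤ 0.63663 * 1.4144 :=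
      mul_le_mul rho_lt.le this.le (by positivity) (by norm_num)
    linarith
  calc gap (π / 3) ^ 3 < 0.45 ^ 3 := by
        gcongr
        exact (gap_pos _).le
    _ < 0.5497 ^ 4 := by norm_num
    _ < gap (π / 4) ^ 4 := by gcongr

theorem logGap_pow (n : ℕ) (x : ℝ) : n * logGap x = log (gap x ^ n) := by
  rw [logGap, log_pow]

theorem gap_pow_le {m n : ℕ} {x y : ℝ} : gap x ^ m ≤ gap y ^ n ↔
    (m : ℝ) * logGap x ≤ n * logGap y := by
  rw [logGap_pow, logGap_pow, log_le_log_iff (pow_pos (gap_pos _) _) (pow_pos (gap_pos _) _)]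

theorem gap_pow_lt {m n : ℕ} {x y : ℝ} : gap x ^ m < gap y ^ n ↔
    (m : ℝ) * logGap x < n * logGap y := by
  rw [logGap_pow, logGap_pow, log_lt_log_iff (pow_pos (gap_pos _) _) (pow_pos (gap_pos _) _)]

/-- If the total is large, three equal angles are better than `(a, a, b)` with `b ≤ a`. -/
theorem three_le_of_large {S b : ℝ} (hS : 2 * angA ≤ S) (hSp : S ≤ π) (hb0 : 0 ≤ b)
    (hb : b ≤ S / 3) : 3 * logGap (S / 3) ≤ 2 * logGap ((S - b) / 2) + logGap b := by
  have hA0 := angA_gt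
  have hA1 := angA_lt
  have hpi := pi_pos
  rcases le_total b (2 * angA / 3) with h | h
  -- For small `b` the left side minus the `S`-dependent term on the right decreases in `S`. So `S =
  -- 2 angA` suffices, where the path still starts with a critical pair.
  · have hder (x : ℝ) : HasDerivAt (fun S => 3 * logGap (S / 3) - 2 * logGap ((S - b) / 2))
        (rho * (relSlope ((x - b) / 2) - relSlope (x / 3))) x := by
      have h1 := ((hasDerivAt_logGap (x / 3)).comp x ((hasDerivAt_id x).div_const 3)).const_mul 3
      have h2 := ((hasDerivAt_logGap ((x - b) / 2)).comp x
        (((hasDerivAt_id x).sub_const b).div_const 2)).const_mul 2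
      refine (h1.sub h2).congr_deriv ?_
      ring
    have hanti := antitoneOn_of_hasDerivAt (u := 2 * angA) (v := π) hder (by
      intro x hx
      have hx1 := hx.1
      have hx2 := hx.2
      have : rho ≤ sin (x / 3) := rho_lt_sin_two_thirds_angA.le.trans
        (sin_le_sin_of_le_of_le_pi_div_two (by linarith) (by linarith) (by linarith))
      have := relSlope_anti (a := (x - b) / 2) (b := x / 3) (by linarith) this (by linarith)
        (by linarith)
      exact mul_nonpos_of_nonneg_of_nonpos rho_pos.le (by linarith))
    have h1 := hanti ⟨le_rfl, hS.trans hSp⟩ ⟨hS, hSp⟩ hS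
    have h0 : pathSign 2 (2 * angA) 0 ≤ 0 := by
      have e : 2 * angA / 2 / 2 = angA / 2 := by ring
      simp only [pathSign, sub_zero, add_zero, e, sin_angA_half, sub_self, le_refl]
    have h2 := pathLog_ends (k := 2) (S := 2 * angA) (b := b) le_rfl (by norm_num) (by linarith)
      hb0 (by norm_num; exact h) h0
    have h3 := gap_two_thirds_angA
    rw [gap_pow_lt] at h3
    have e : 2 * angA / 2 = angA := by ring
    norm_num [pathLog, e] at h1 h2 h3
    rcases h2 with h2 | h2 <;> linarith
  -- For larger `b` the means `(S + x) / 4` are at least `2 angA / 3`, where the sine exceeds `ρ`.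
  -- So the product falls all the way to three equal angles.
  · have := pathLog_end_le (k := 2) (S := S) (b := b) le_rfl hSp hb0 (by norm_num; exact hb) (by
      intro x hx
      norm_num at hx
      have hx1 := hx.1
      have hx2 := hx.2
      have : rho ≤ sin (((S - x) / 2 + x) / 2) := rho_lt_sin_two_thirds_angA.le.trans
        (sin_le_sin_of_le_of_le_pi_div_two (by linarith) (by linarith) (by linarith))
      rw [pathSign]
      nlinarith [cos_le_one (((S - x) / 2 - x) / 2), rho_pos])
    norm_num [pathLog] at this
    linarith

/-- The difference of the two sides grows with `S` in this range, so the numerical comparison at `S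
= π` suffices. -/
theorem three_le_four {S : ℝ} (hS0 : 0 ≤ S) (hS : S ≤ π) (h : rho ≤ sin (S / 4)) :
    3 * logGap (S / 3) ≤ 4 * logGap (S / 4) := by
  have hpi := pi_pos
  have hder (x : ℝ) : HasDerivAt (fun S => 3 * logGap (S / 3) - 4 * logGap (S / 4))
      (rho * (relSlope (x / 4) - relSlope (x / 3))) x := by
    have h1 := ((hasDerivAt_logGap (x / 3)).comp x ((hasDerivAt_id x).div_const 3)).const_mul 3
    have h2 := ((hasDerivAt_logGap (x / 4)).comp x ((hasDerivAt_id x).div_const 4)).const_mul 4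
    refine (h1.sub h2).congr_deriv ?_
    ring
  have hmono := monotoneOn_of_hasDerivAt (u := S) (v := π) hder (by
    intro x hx
    have hx1 := hx.1
    have hx2 := hx.2
    have : rho ≤ sin (x / 4) := h.trans
      (sin_le_sin_of_le_of_le_pi_div_two (by linarith) (by linarith) (by linarith))
    have := relSlope_anti (a := x / 3) (b := x / 4) (by linarith) this (by linarith)
      (by linarith)
    exact mul_nonneg rho_pos.le (by linarith))
  have h1 := hmono ⟨le_rfl, hS⟩ ⟨hS, le_rfl⟩ hS
  have h3 := gap_pi_div_three
  rw [gap_pow_lt] at h3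
  norm_num at h1 h3
  linarith

/-! ### Reduction to at most three angles -/

/-- The admissible tuples of angles with total `S`. -/
def angleSet (n : ℕ) (S : ℝ) : Set (Fin n → ℝ) :=
  {v | (∀ i, v i ∈ Set.Icc 0 (π / 2)) ∧ ∑ i, v i = S}

/-- Compactness gives a minimiser, and sorting preserves its sum and product. -/
theorem exists_monotone_min {n : ℕ} {S : ℝ} (h : (angleSet n S).Nonempty) :
    ∃ v ∈ angleSet n S, Monotone v ∧ ∀ w ∈ angleSet n S, ∏ i, gap (v i) ≤ ∏ i, gap (w i) := by
  have hcomp : IsCompact (angleSet n S) := by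
    have h1 : IsCompact (Set.univ.pi fun _ : Fin n => Set.Icc (0 : ℝ) (π / 2)) :=
      isCompact_univ_pi fun _ => isCompact_Icc
    have h2 : IsClosed {v : Fin n → ℝ | ∑ i, v i = S} :=
      isClosed_eq (by fun_prop) continuous_const
    convert h1.inter_right h2 using 1
    ext v
    simp only [angleSet, Set.mem_ofPred_eq, Set.mem_inter_iff, Set.mem_pi, Set.mem_univ,
      true_imp_iff]
  have hcont : Continuous fun v : Fin n → ℝ => ∏ i, gap (v i) :=
    continuous_finsetProd _ fun i _ => continuous_gap.comp (continuous_apply i)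
  obtain ⟨v, hv, hmin⟩ := hcomp.exists_isMinOn h hcont.continuousOn
  refine ⟨v ∘ Tuple.sort v, ⟨fun i => hv.1 _, ?_⟩, Tuple.monotone_sort v, fun w hw => ?_⟩
  · rw [← hv.2]
    exact Equiv.sum_comp (Tuple.sort v) v
  · have := Equiv.prod_comp (Tuple.sort v) fun i => gap (v i)
    simp only [Function.comp_apply]
    rw [this]
    exact hmin hw

/-- Uniqueness of the critical partner of `x` forces `y = z`; then criticality of `(y, z)` reads
`sin y = ρ`, against the strict inequality. -/
theorem not_crit_triple {x y z : ℝ} (hx : x ∈ Set.Icc 0 (π / 2)) (hy : y ∈ Set.Icc 0 (π / 2))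
    (hz : z ∈ Set.Icc 0 (π / 2)) (hxy : sin ((x + y) / 2) = rho * cos ((x - y) / 2))
    (hxz : sin ((x + z) / 2) = rho * cos ((x - z) / 2)) (hyz : sin ((y + z) / 2) < rho)
    (hyz' : sin ((y + z) / 2) = rho * cos ((y - z) / 2)) : False := by
  have h := crit_unique hx hy hz hxy hxz
  subst h
  simp at hyz'
  rw [add_self_div_two] at hyz
  exact hyz.ne hyz'

theorem sin_half_mono {a b : ℝ} (h0 : 0 ≤ b) (h1 : b ≤ a) (h2 : a ≤ π) :
    sin (b / 2) ≤ sin (a / 2) :=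
  sin_le_sin_of_le_of_le_pi_div_two (by linarith [pi_pos]) (by linarith) (by linarith)

theorem rho_mul_cos_le_sin {s : ℝ} (h : angA / 2 < s) (h1 : s ≤ π / 2) :
    rho * cos s ≤ sin s := by
  by_contra! h2
  exact h.not_ge ((sin_le_iff (by linarith [angA_pos]) h1).1 h2.le)

/-- In a triple that is optimal for its sum and has no pair that can be merged, the two largest
angles agree. -/
theorem eq_of_optimal_triple {a b c : ℝ} (ha : a ∈ Set.Icc 0 (π / 2))
    (hb : b ∈ Set.Icc 0 (π / 2)) (hc : c ∈ Set.Icc 0 (π / 2)) (hba : b ≤ a) (hcb : c ≤ b)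
    (hmin : ∀ x ∈ Set.Icc 0 (π / 2), ∀ y ∈ Set.Icc 0 (π / 2), ∀ z ∈ Set.Icc 0 (π / 2),
      x + y + z = a + b + c → gap a * gap b * gap c ≤ gap x * gap y * gap z)
    (hs : angA / 2 < (b + c) / 2) : a = b := by
  have hab := eq_or_crit ha hb (fun x hx y hy h => by
    refine le_of_mul_le_mul_right ?_ (gap_pos c)
    exact hmin x hx y hy c hc (by linarith))
    (rho_mul_cos_le_sin (by linarith) (by linarith [ha.2, hb.2]))
  have hac := eq_or_crit ha hc (fun x hx y hy h => by
    refine le_of_mul_le_mul_right ?_ (gap_pos b)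
    have := hmin x hx y hy b hb (by linarith)
    linarith)
    (rho_mul_cos_le_sin (by linarith) (by linarith [ha.2, hc.2]))
  have hbc := eq_or_crit hb hc (fun x hx y hy h => by
    refine le_of_mul_le_mul_right ?_ (gap_pos a)
    have := hmin x hx y hy a ha (by linarith)
    linarith)
    (rho_mul_cos_le_sin (by linarith) (by linarith [hb.2, hc.2]))
  rcases hab with hab | ⟨h1, h2⟩
  · exact hab.1
  exfalso
  -- The two largest angles have the largest half-sum, so the other pairs lie below `ρ` too and must
  -- be critical.
  have h3 : sin ((a + c) / 2) < rho :=
    (sin_half_mono (by linarith [ha.1, hc.1]) (by linarith) (by linarith [ha.2, hb.2])).trans_lt h1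
  have h4 : sin ((b + c) / 2) < rho :=
    (sin_half_mono (by linarith [hb.1, hc.1]) (by linarith) (by linarith [ha.2, hb.2])).trans_lt h1
  rcases hac with ⟨-, hac⟩ | ⟨-, hac⟩
  · exact h3.not_ge hac
  rcases hbc with ⟨-, hbc⟩ | ⟨-, hbc⟩
  · exact h4.not_ge hbc
  · exact not_crit_triple ha hb hc h2 hac h4 hbc

theorem pathSign_zero_le {k S : ℝ} (hk : 2 ≤ k) (hS0 : 0 ≤ S) (hSp : S ≤ π)
    (h : S / k ≤ angA) : pathSign k S 0 ≤ 0 := by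
  have h1 : 0 ≤ S / k := by positivity
  have := (sin_le_iff (s := S / k / 2) (by linarith) (by linarith [angA_lt, pi_pos])).2
    (by linarith)
  rw [pathSign]
  simp only [sub_zero, add_zero]
  linarith

theorem log_gap_mul {a b : ℝ} (n : ℕ) :
    n * logGap a + logGap b = log (gap a ^ n * gap b) := by
  rw [log_mul (pow_pos (gap_pos a) n).ne' (gap_pos b).ne', log_pow, logGap, logGap]

theorem gap_pow_le_mul {a b c : ℝ} {m n : ℕ} (h : (m : ℝ) * logGap c ≤ n * logGap a + logGap b) :
    gap c ^ m ≤ gap a ^ n * gap b := by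
  rw [log_gap_mul, logGap_pow] at h
  exact (log_le_log_iff (pow_pos (gap_pos _) _)
    (mul_pos (pow_pos (gap_pos _) _) (gap_pos _))).1 h

theorem triple_reduce {a b c : ℝ} (ha : a ∈ Set.Icc 0 (π / 2))
    (hb : b ∈ Set.Icc 0 (π / 2)) (hc : c ∈ Set.Icc 0 (π / 2)) (hS : a + b + c ≤ π) :
    (∃ x ∈ Set.Icc 0 (π / 2), ∃ y ∈ Set.Icc 0 (π / 2), x + y = a + b + c ∧
      gap x * gap y ≤ gap a * gap b * gap c) ∨
    gap ((a + b + c) / 3) ^ 3 ≤ gap a * gap b * gap c := by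
  have hpi := pi_pos
  obtain ⟨S, hSe⟩ : ∃ S, S = a + b + c := ⟨_, rfl⟩
  obtain ⟨v, ⟨hv, hvS⟩, hmono, hmin⟩ := exists_monotone_min (n := 3) (S := S) ⟨![a, b, c],
    by simp [Fin.forall_fin_succ, ha.1, ha.2, hb.1, hb.2, hc.1, hc.2],
    by simp [Fin.sum_univ_three, hSe]⟩
  have hmin' : ∀ x ∈ Set.Icc 0 (π / 2), ∀ y ∈ Set.Icc 0 (π / 2), ∀ z ∈ Set.Icc 0 (π / 2),
      x + y + z = S → gap (v 2) * gap (v 1) * gap (v 0) ≤ gap x * gap y * gap z := by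
    intro x hx y hy z hz h
    have := hmin ![x, y, z]
      ⟨by simp [Fin.forall_fin_succ, hx.1, hx.2, hy.1, hy.2, hz.1, hz.2],
        by simp [Fin.sum_univ_three, h]⟩
    simp [Fin.prod_univ_three] at this
    linarith
  have habc := hmin' a ha b hb c hc hSe.symm
  rw [Fin.sum_univ_three] at hvS
  have h01 : v 0 ≤ v 1 := hmono (by decide)
  have h12 : v 1 ≤ v 2 := hmono (by decide)
  have h0 := hv 0
  have h1 := hv 1
  have h2 := hv 2
  generalize v 0 = r at *
  generalize v 1 = q at *
  generalize v 2 = p at *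
  rw [← hSe] at hS ⊢
  clear hv hmono hmin
  -- Either the two smallest angles merge, or the two largest agree and the path with `k = 2`
  -- applies.
  rcases le_or_gt ((q + r) / 2) (angA / 2) with h | h
  · left
    have hle := (sin_le_iff (by linarith [h0.1, h1.1]) (by linarith [h0.2, h1.2])).2 h
    have := gap_add_le h1.1 h0.1 (by linarith [h0.2, h1.2]) hle
    refine ⟨p, h2, q + r, ⟨by linarith [h0.1, h1.1], by linarith [angA_lt]⟩, by linarith, ?_⟩
    refine le_trans ?_ habc
    rw [mul_assoc]
    exact mul_le_mul_of_nonneg_left this (gap_pos p).le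
  · have hpq := eq_of_optimal_triple h2 h1 h0 h12 h01
      (fun x hx y hy z hz he => hmin' x hx y hy z hz (by linarith)) h
    subst hpq
    have hp : p = (S - r) / 2 := by linarith
    rw [← sq] at habc
    have hS0 : 0 ≤ S := by linarith [h0.1, h1.1]
    rcases le_total S (2 * angA) with h' | h'
    · have hends := pathLog_ends (k := 2) (S := S) (b := r) le_rfl (by norm_num) hS h0.1
        (by norm_num; linarith) (pathSign_zero_le le_rfl hS0 hS (by linarith))
      norm_num [pathLog] at hends
      rw [← hp] at hends
      rcases hends with he | he
      · left
        have := gap_pow_le_mul (m := 2) (n := 2) (by exact_mod_cast he : ((2 : ℕ) : ℝ) * _ ≤ _)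
        refine ⟨S / 2, ⟨by linarith, by linarith⟩, S / 2, ⟨by linarith, by linarith⟩,
          by linarith, ?_⟩
        rw [← sq]
        exact this.trans habc
      · right
        exact (gap_pow_le_mul (m := 3) (n := 2) (by exact_mod_cast he)).trans habc
    · right
      have he := three_le_of_large h' hS h0.1 (by linarith)
      rw [← hp] at he
      exact (gap_pow_le_mul (m := 3) (n := 2) (by exact_mod_cast he)).trans habc

theorem quadruple_reduce {a b c d : ℝ} (ha : a ∈ Set.Icc 0 (π / 2))
    (hb : b ∈ Set.Icc 0 (π / 2)) (hc : c ∈ Set.Icc 0 (π / 2)) (hd : d ∈ Set.Icc 0 (π / 2))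
    (hS : a + b + c + d ≤ π) :
    ∃ x ∈ Set.Icc 0 (π / 2), ∃ y ∈ Set.Icc 0 (π / 2), ∃ z ∈ Set.Icc 0 (π / 2),
      x + y + z = a + b + c + d ∧ gap x * gap y * gap z ≤ gap a * gap b * gap c * gap d := by
  have hpi := pi_pos
  obtain ⟨S, hSe⟩ : ∃ S, S = a + b + c + d := ⟨_, rfl⟩
  obtain ⟨v, ⟨hv, hvS⟩, hmono, hmin⟩ := exists_monotone_min (n := 4) (S := S) ⟨![a, b, c, d],
    by simp [Fin.forall_fin_succ, ha.1, ha.2, hb.1, hb.2, hc.1, hc.2, hd.1, hd.2],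
    by simp [Fin.sum_univ_four, hSe]⟩
  have hmin' : ∀ x ∈ Set.Icc 0 (π / 2), ∀ y ∈ Set.Icc 0 (π / 2), ∀ z ∈ Set.Icc 0 (π / 2),
      ∀ w ∈ Set.Icc 0 (π / 2), x + y + z + w = S →
      gap (v 3) * gap (v 2) * gap (v 1) * gap (v 0) ≤ gap x * gap y * gap z * gap w := by
    intro x hx y hy z hz w hw h
    have := hmin ![x, y, z, w]
      ⟨by simp [Fin.forall_fin_succ, hx.1, hx.2, hy.1, hy.2, hz.1, hz.2, hw.1, hw.2],
        by simp [Fin.sum_univ_four, h]⟩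
    simp [Fin.prod_univ_four] at this
    linarith
  have habc := hmin' a ha b hb c hc d hd hSe.symm
  rw [Fin.sum_univ_four] at hvS
  have h01 : v 0 ≤ v 1 := hmono (by decide)
  have h12 : v 1 ≤ v 2 := hmono (by decide)
  have h23 : v 2 ≤ v 3 := hmono (by decide)
  have h0 := hv 0
  have h1 := hv 1
  have h2 := hv 2
  have h3 := hv 3
  generalize v 0 = r at *
  generalize v 1 = q at *
  generalize v 2 = p at *
  generalize v 3 = o at *
  rw [← hSe] at hS ⊢
  clear hv hmono hmin
  rcases le_or_gt ((q + r) / 2) (angA / 2) with h | h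
  · have hle := (sin_le_iff (by linarith [h0.1, h1.1]) (by linarith [h0.2, h1.2])).2 h
    have := gap_add_le h1.1 h0.1 (by linarith [h0.2, h1.2]) hle
    refine ⟨o, h3, p, h2, q + r, ⟨by linarith [h0.1, h1.1], by linarith [angA_lt]⟩,
      by linarith, ?_⟩
    refine le_trans ?_ habc
    rw [mul_assoc (gap o * gap p)]
    exact mul_le_mul_of_nonneg_left this (mul_pos (gap_pos o) (gap_pos p)).le
  · have hop := eq_of_optimal_triple h3 h2 h1 h23 h12
      (fun x hx y hy z hz he => by
        refine le_of_mul_le_mul_right ?_ (gap_pos r)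
        exact hmin' x hx y hy z hz r h0 (by linarith)) (by linarith)
    have hpq := eq_of_optimal_triple h2 h1 h0 h12 h01
      (fun x hx y hy z hz he => by
        refine le_of_mul_le_mul_left ?_ (gap_pos o)
        have := hmin' o h3 x hx y hy z hz (by linarith)
        linarith) h
    subst hpq
    subst hop
    have hp : o = (S - r) / 3 := by linarith
    have hS0 : 0 ≤ S := by linarith [h0.1, h1.1]
    have hcube : gap o * gap o * gap o = gap o ^ 3 := by ring
    rw [hcube] at habc
    have hle : gap (S / 3) ^ 3 ≤ gap o ^ 3 * gap r := by
      refine gap_pow_le_mul (m := 3) (n := 3) ?_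
      -- Since `S / 3 ≤ π / 3 < angA`, the path with `k = 3` always has a nonpositive sign at its
      -- start.
      have h0le := pathSign_zero_le (k := 3) (by norm_num) hS0 hS (by linarith [angA_gt])
      have hend := pathLog_ends (k := 3) (S := S) (b := r) (by norm_num) le_rfl hS h0.1
        (by norm_num; linarith) h0le
      norm_num [pathLog] at hend
      rw [← hp] at hend
      push_cast
      rcases hend with he | he
      · exact he
      -- Four equal angles lose to three if `sin (S/4) ≥ ρ`. Otherwise the sign is nonpositive at
      -- both ends, so by convexity the product never falls along the path.
      · rcases le_or_gt rho (sin (S / 4)) with hr | hr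
        · exact (three_le_four hS0 hS hr).trans he
        · have hc3 := convexOn_pathSign (k := 3) (S := S) (by norm_num) le_rfl hS
          have hlast : pathSign 3 S (S / (3 + 1)) ≤ 0 := by
            have e1 : ((S - S / (3 + 1)) / 3 + S / (3 + 1)) / 2 = S / 4 := by ring
            have e2 : ((S - S / (3 + 1)) / 3 - S / (3 + 1)) / 2 = 0 := by ring
            rw [pathSign, e1, e2, cos_zero]
            linarith
          have := pathLog_start_le (k := 3) (S := S) (b := r) (by norm_num) hS h0.1
            (by norm_num; linarith) (fun x hx => by
              have hx2 : x ≤ S / (3 + 1) := by norm_num; linarith [hx.2]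
              exact (hc3.le_max_of_mem_Icc ⟨le_rfl, hx.1.trans hx2⟩ ⟨hx.1.trans hx2, le_rfl⟩
                ⟨hx.1, hx2⟩).trans (max_le h0le hlast))
          rw [pathLog, ← hp] at this
          exact this
    have hm : S / 3 ∈ Set.Icc 0 (π / 2) := ⟨by linarith, by linarith⟩
    refine ⟨S / 3, hm, S / 3, hm, S / 3, hm, by ring, ?_⟩
    have e : gap (S / 3) * gap (S / 3) * gap (S / 3) = gap (S / 3) ^ 3 := by ring
    rw [e]
    exact hle.trans habc

theorem exists_triple {f : ℕ → ℝ} (hf : ∀ i, f i ∈ Set.Icc 0 (π / 2)) (n : ℕ)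
    (hS : ∑ i ∈ Finset.range n, f i ≤ π) :
    ∃ x ∈ Set.Icc 0 (π / 2), ∃ y ∈ Set.Icc 0 (π / 2), ∃ z ∈ Set.Icc 0 (π / 2),
      x + y + z = ∑ i ∈ Finset.range n, f i ∧
      gap x * gap y * gap z ≤ ∏ i ∈ Finset.range n, gap (f i) := by
  induction n with
  | zero =>
    have h0 : (0 : ℝ) ∈ Set.Icc 0 (π / 2) := ⟨le_rfl, by positivity⟩
    exact ⟨0, h0, 0, h0, 0, h0, by simp⟩
  | succ n ih =>
    rw [Finset.sum_range_succ] at hS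
    obtain ⟨x, hx, y, hy, z, hz, hs, hp⟩ := ih (by linarith [(hf n).1])
    obtain ⟨x', hx', y', hy', z', hz', hs', hp'⟩ :=
      quadruple_reduce hx hy hz (hf n) (by linarith)
    refine ⟨x', hx', y', hy', z', hz', ?_, ?_⟩
    · rw [Finset.sum_range_succ, hs', hs]
    · rw [Finset.prod_range_succ]
      exact hp'.trans (mul_le_mul_of_nonneg_right hp (gap_pos _).le)

/-! ### The formula for `T` -/

theorem one_sub_two_mul_seqW (l : ℕ → ℝ) (n : ℕ) :
    1 - 2 * seqW l n = ∏ j ∈ Finset.range n, (1 - 2 * l j) := by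
  induction n with
  | zero => simp [seqW]
  | succ n ih =>
    rw [Finset.prod_range_succ, ← ih, seqW]
    ring

theorem maxW_eq {l : ℕ → ℝ} (hl : l ∈ paramSet) {n : ℕ} (hn : ∀ j, n ≤ j → l j = 0) :
    maxW l = seqW l n := by
  have hg := isGreatest_maxW hl
  refine le_antisymm ?_ (hg.2 ⟨n, rfl⟩)
  obtain ⟨j, hj⟩ := hg.1
  rw [← hj]
  have hmono : Monotone (seqW l) := by
    refine monotone_nat_of_le_succ fun j => ?_
    have hb := paramSet_bounds hl j
    have ht := seqW_bounds hl j
    simp only [seqW]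
    nlinarith [ht.1, ht.2, hb.1, hb.2]
  have hconst : ∀ k, seqW l (n + k) = seqW l n := by
    intro k
    induction k with
    | zero => rfl
    | succ k ih => rw [← add_assoc, seqW, hn (n + k) (by omega), ih]; ring
  rw [← hconst j]
  exact hmono (by omega)

theorem gap_arcsin {x : ℝ} (h0 : 0 ≤ x) (h1 : x ≤ 1 / π) : gap (arcsin (π * x)) = 1 - 2 * x := by
  have hpi := pi_pos
  rw [le_div_iff₀ hpi] at h1
  rw [gap, sin_arcsin (by nlinarith) (by linarith), rho]
  field_simp

theorem one_sub_eq_gap {x : ℝ} : 1 - 2 * (sin x / π) = gap x := by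
  rw [gap, rho]
  ring

theorem triple_le_optT {θ x y z : ℝ} (h0 : 0 ≤ θ) (h1 : θ ≤ π / 2)
    (hx : x ∈ Set.Icc 0 (π / 2)) (hy : y ∈ Set.Icc 0 (π / 2)) (hz : z ∈ Set.Icc 0 (π / 2))
    (h : x + y + z = 2 * θ) : (1 - gap x * gap y * gap z) / 2 ≤ optT θ := by
  have hpi := pi_pos
  let f : ℕ → ℝ := fun j => if j = 0 then x else if j = 1 then y else if j = 2 then z else 0
  have hf (j : ℕ) : f j ∈ Set.Icc 0 (π / 2) := by
    simp only [f]
    split_ifs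
    · exact hx
    · exact hy
    · exact hz
    · exact ⟨le_rfl, by positivity⟩
  have hf3 (j : ℕ) (hj : 3 ≤ j) : f j = 0 := by
    simp only [f]
    rw [if_neg (by omega), if_neg (by omega), if_neg (by omega)]
  let l : ℕ → ℝ := fun j => sin (f j) / π
  have hl3 (j : ℕ) (hj : 3 ≤ j) : l j = 0 := by simp [l, hf3 j hj]
  have hl : l ∈ paramSet := by
    refine ⟨2, fun j _ => ⟨?_, ?_⟩, fun j hj => hl3 j hj⟩
    · exact div_nonneg (sin_nonneg_of_nonneg_of_le_pi (hf j).1 (by linarith [(hf j).2])) hpi.le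
    · exact div_le_div_of_nonneg_right (sin_le_one _) hpi.le
  have hrot (j : ℕ) : rotM (l j) = f j / 2 := by
    have : π * (sin (f j) / π) = sin (f j) := by field_simp
    rw [rotM, this, arcsin_sin (by linarith [(hf j).1]) (hf j).2]
    ring
  refine (isLUB_optT h0 h1).1 ⟨l, ⟨hl, ?_⟩, ?_⟩
  · rw [tsum_eq_sum (s := Finset.range 3)]
    · simp only [hrot, Finset.sum_range_succ, Finset.sum_range_zero, f]
      norm_num
      linarith
    · intro j hj
      rw [hrot, hf3 j (by simpa using hj), zero_div]
  · rw [maxW_eq hl hl3]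
    have := one_sub_two_mul_seqW l 3
    simp only [Finset.prod_range_succ, Finset.prod_range_zero, l, one_sub_eq_gap, f] at this
    norm_num at this
    linarith

/-- The minimum of `gap x * gap y` over the pairs with `x + y = 2 θ`. -/
noncomputable def pairMin (θ : ℝ) : ℝ :=
  if sin θ ≤ rho * cos θ then gap (2 * θ)
  else if sin θ ≤ rho then (1 - rho ^ 2) * cos θ ^ 2
  else gap θ ^ 2

theorem pairMin_le {θ x y : ℝ} (hx : x ∈ Set.Icc 0 (π / 2)) (hy : y ∈ Set.Icc 0 (π / 2))
    (h : x + y = 2 * θ) : pairMin θ ≤ gap x * gap y := by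
  have e : (x + y) / 2 = θ := by linarith
  rw [pairMin]
  split_ifs with h1 h2
  · rw [← h]
    refine gap_add_le hx.1 hy.1 (by linarith [hx.2, hy.2, pi_pos]) ?_
    rwa [e]
  · rw [← e]
    exact le_gap_mul_gap x y
  · rw [← e]
    apply gap_half_sq_le
    rw [e]
    exact (not_le.1 h2).le

theorem exists_pairMin {θ : ℝ} (h0 : 0 ≤ θ) (h1 : θ ≤ π / 2) :
    ∃ x ∈ Set.Icc 0 (π / 2), ∃ y ∈ Set.Icc 0 (π / 2), x + y = 2 * θ ∧
      gap x * gap y = pairMin θ := by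
  have hpi := pi_pos
  rw [pairMin]
  split_ifs with h2 h3
  · rw [sin_le_iff h0 h1] at h2
    exact ⟨2 * θ, ⟨by linarith, by linarith [angA_lt]⟩, 0, ⟨le_rfl, by linarith⟩, by ring, by simp⟩
  · exact exists_pair h0 h1 (not_le.1 h2).le h3
  · exact ⟨θ, ⟨h0, h1⟩, θ, ⟨h0, h1⟩, by ring, by ring⟩

/-- Every sequence reduces to a triple and then to one of the two candidates. Both candidates are
themselves triples, the pair being padded with the angle `0`. -/
theorem optT_eq {θ : ℝ} (h0 : 0 ≤ θ) (h1 : θ ≤ π / 2) :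
    optT θ = (1 - min (pairMin θ) (gap (2 * θ / 3) ^ 3)) / 2 := by
  have hpi := pi_pos
  apply le_antisymm
  · refine (isLUB_optT h0 h1).2 ?_
    rintro _ ⟨l, ⟨hl, hsum⟩, rfl⟩
    obtain ⟨n, hn, hn0⟩ := id hl
    have hb (j : ℕ) : 0 ≤ l j ∧ l j ≤ 1 / π := by
      rcases Nat.lt_or_ge n j with h | h
      · rw [hn0 j h]
        exact ⟨le_rfl, by positivity⟩
      · exact hn j h
    rw [tsum_eq_sum (s := Finset.range (n + 1))
      (fun j hj => by simp [rotM, hn0 j (by simpa using hj)])] at hsum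
    simp only [rotM, ← Finset.mul_sum] at hsum
    have hW := one_sub_two_mul_seqW l (n + 1)
    rw [maxW_eq hl hn0]
    have hgap : ∏ j ∈ Finset.range (n + 1), (1 - 2 * l j) =
        ∏ j ∈ Finset.range (n + 1), gap (arcsin (π * l j)) :=
      Finset.prod_congr rfl fun j _ => (gap_arcsin (hb j).1 (hb j).2).symm
    rw [hgap] at hW
    obtain ⟨x, hx, y, hy, z, hz, hs, hp⟩ := exists_triple (f := fun j => arcsin (π * l j))
      (fun j => ⟨arcsin_nonneg.2 (mul_nonneg hpi.le (hb j).1), arcsin_le_pi_div_two _⟩) (n + 1)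
      (by linarith)
    have hs2 : x + y + z = 2 * θ := by linarith
    suffices h : min (pairMin θ) (gap (2 * θ / 3) ^ 3) ≤ gap x * gap y * gap z by linarith
    rcases triple_reduce hx hy hz (by linarith) with ⟨u, hu, v, hv, huv, hle⟩ | hle
    · exact (min_le_left _ _).trans ((pairMin_le hu hv (huv.trans hs2)).trans hle)
    · rw [hs2] at hle
      exact (min_le_right _ _).trans hle
  · rcases min_choice (pairMin θ) (gap (2 * θ / 3) ^ 3) with h | h
    · rw [h]
      obtain ⟨x, hx, y, hy, hxy, he⟩ := exists_pairMin h0 h1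
      have := triple_le_optT h0 h1 hx hy (z := 0) ⟨le_rfl, by linarith⟩ (by linarith)
      rwa [gap_zero, mul_one, he] at this
    · rw [h]
      have hm : 2 * θ / 3 ∈ Set.Icc 0 (π / 2) := ⟨by linarith, by linarith⟩
      have := triple_le_optT h0 h1 hm hm hm (by ring)
      have e : gap (2 * θ / 3) * gap (2 * θ / 3) * gap (2 * θ / 3) = gap (2 * θ / 3) ^ 3 := by ring
      rwa [e] at this

/-- The formulas agree at the seams `sin θ = ρ cos θ` and `sin θ = ρ`. Continuity later turns
injectivity of `T` into monotonicity. -/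
theorem continuous_pairMin : Continuous pairMin := by
  have hg := continuous_gap
  unfold pairMin
  refine Continuous.if_le (by fun_prop) (Continuous.if_le (by fun_prop) (by fun_prop)
    (by fun_prop) (by fun_prop) ?_) (by fun_prop) (by fun_prop) ?_
  · intro θ h
    rw [gap, cos_sq', h]
    ring
  · intro θ h
    have h1 : sin θ ≤ rho := by
      rw [h]
      nlinarith [cos_le_one θ, rho_pos]
    rw [if_pos h1, gap, sin_two_mul]
    have := sin_sq_add_cos_sq θ
    linear_combination (-2 * rho * cos θ) * h - this +
      (sin θ + rho * cos θ) * h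

/-! ### The crossing of the two candidates and `κ` -/

/-- The logarithm of the quotient of `gap (2 θ / 3) ^ 3` and `gap θ ^ 2`. -/
noncomputable def crossLog (θ : ℝ) : ℝ := 3 * logGap (2 * θ / 3) - 2 * logGap θ

theorem hasDerivAt_crossLog (x : ℝ) :
    HasDerivAt crossLog (2 * rho * (relSlope x - relSlope (2 * x / 3))) x := by
  have h0 : HasDerivAt (fun x : ℝ => 2 * x / 3) (2 * 1 / 3) x :=
    ((hasDerivAt_id x).const_mul 2).div_const 3
  have h1 := ((hasDerivAt_logGap (2 * x / 3)).comp x h0).const_mul 3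
  refine (h1.sub ((hasDerivAt_logGap x).const_mul 2)).congr_deriv ?_
  ring

@[simp] theorem crossLog_zero : crossLog 0 = 0 := by simp [crossLog]

theorem crossLog_pos_iff {θ : ℝ} : 0 < crossLog θ ↔ gap θ ^ 2 < gap (2 * θ / 3) ^ 3 := by
  rw [gap_pow_lt, crossLog, sub_pos]
  norm_num

theorem crossLog_nonneg_iff {θ : ℝ} : 0 ≤ crossLog θ ↔ gap θ ^ 2 ≤ gap (2 * θ / 3) ^ 3 := by
  rw [gap_pow_le, crossLog, sub_nonneg]
  norm_num

theorem crossLog_neg_iff {θ : ℝ} : crossLog θ < 0 ↔ gap (2 * θ / 3) ^ 3 < gap θ ^ 2 := by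
  rw [gap_pow_lt, crossLog, sub_neg]
  norm_num

theorem crossLog_eq_zero_iff {θ : ℝ} : crossLog θ = 0 ↔ gap (2 * θ / 3) ^ 3 = gap θ ^ 2 := by
  rw [← not_iff_not, ← ne_eq, ← ne_eq, ne_iff_lt_or_gt, ne_iff_lt_or_gt,
    crossLog_pos_iff, crossLog_neg_iff]

/-- For `0 < x ≤ π/2` the derivative of `crossLog` has the sign of `ρ cos (x/6) - sin (5x/6)`, which
decreases. So `crossLog` rises from `0` and then falls, and has at most one positive zero. -/
theorem crossLog_sign_mono {x z : ℝ} (hx : 0 ≤ x) (hxz : x < z) (hz : z ≤ π / 2) :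
    sin (5 * x / 6) < sin (5 * z / 6) ∧ cos (z / 6) ≤ cos (x / 6) :=
  ⟨sin_lt_sin_of_lt_of_le_pi_div_two (by linarith [pi_pos]) (by linarith) (by linarith),
    cos_le_cos_of_nonneg_of_le_pi (by linarith) (by linarith) (by linarith)⟩

theorem crossLog_pos_of_sin_le {z : ℝ} (h0 : 0 < z) (hz : z ≤ π / 2)
    (h : sin (5 * z / 6) ≤ rho * cos (z / 6)) : 0 < crossLog z := by
  rw [← crossLog_zero]
  refine strictMonoOn_of_hasDerivAt hasDerivAt_crossLog ?_ ⟨le_rfl, h0.le⟩ ⟨h0.le, le_rfl⟩ h0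
  intro x hx
  obtain ⟨h1, h2⟩ := crossLog_sign_mono hx.1.le hx.2 hz
  have hr := rho_pos
  have := relSlope_lt (a := x) (b := 2 * x / 3) (by linarith [hx.1])
    (by linarith [hx.1, hx.2, pi_pos]) (by
      have e1 : (x + 2 * x / 3) / 2 = 5 * x / 6 := by ring
      have e2 : (x - 2 * x / 3) / 2 = x / 6 := by ring
      rw [e1, e2]
      nlinarith)
  exact mul_pos (by positivity) (by linarith)

theorem crossLog_neg_of_lt {z w : ℝ} (h0 : 0 < z) (hzw : z < w) (hw : w ≤ π / 2)
    (h : crossLog z ≤ 0) : crossLog w < 0 := by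
  have hs : rho * cos (z / 6) < sin (5 * z / 6) := by
    by_contra! hs
    exact (crossLog_pos_of_sin_le h0 (by linarith) hs).not_ge h
  refine lt_of_lt_of_le ?_ h
  refine strictAntiOn_of_hasDerivAt hasDerivAt_crossLog ?_ ⟨le_rfl, hzw.le⟩ ⟨hzw.le, le_rfl⟩ hzw
  intro x hx
  have hr := rho_pos
  obtain ⟨h1, h2⟩ := crossLog_sign_mono h0.le hx.1 (by linarith [hx.2])
  have := relSlope_gt (a := x) (b := 2 * x / 3) (by linarith [hx.1])
    (by linarith [hx.1, hx.2, pi_pos]) (by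
      have e1 : (x + 2 * x / 3) / 2 = 5 * x / 6 := by ring
      have e2 : (x - 2 * x / 3) / 2 = x / 6 := by ring
      rw [e1, e2]
      nlinarith)
  exact mul_neg_of_pos_of_neg (by positivity) (by linarith)

theorem crossLog_pos_of_small {z : ℝ} (h0 : 0 < z) (hz : z ≤ π / 2) (h : sin z ≤ rho) :
    0 < crossLog z := by
  refine crossLog_pos_of_sin_le h0 hz ?_
  -- Otherwise the addition formula gives `sin z > ρ cos² (z/6) + sin² (z/6) ≥ ρ`.
  by_contra! hc
  have e : z = 5 * z / 6 + z / 6 := by ring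
  rw [e, sin_add] at h
  have hv : 0 < sin (z / 6) := sin_pos_of_pos_of_lt_pi (by linarith) (by linarith)
  have hcv : 0 < cos (z / 6) := cos_pos_of_mem_Ioo ⟨by linarith, by linarith⟩
  have huv : sin (z / 6) ≤ cos (5 * z / 6) := by
    rw [← cos_pi_div_two_sub]
    exact cos_le_cos_of_nonneg_of_le_pi (by linarith) (by linarith) (by linarith)
  have h1 := sin_sq_add_cos_sq (z / 6)
  have hr := rho_lt_one
  have hr0 := rho_pos
  have h2 : rho * cos (z / 6) * cos (z / 6) < sin (5 * z / 6) * cos (z / 6) :=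
    mul_lt_mul_of_pos_right hc hcv
  have h3 : sin (z / 6) * sin (z / 6) ≤ cos (5 * z / 6) * sin (z / 6) :=
    mul_le_mul_of_nonneg_right huv hv.le
  nlinarith [mul_pos hv hv]

theorem crossLog_angA : crossLog angA < 0 := crossLog_neg_iff.2 gap_two_thirds_angA

theorem crossLog_pi_div_two : crossLog (π / 2) < 0 :=
  crossLog_neg_of_lt angA_pos angA_lt le_rfl crossLog_angA.le

/-- The positive zero of `crossLog`. -/
def IsCross (θ : ℝ) : Prop := 0 < θ ∧ θ ≤ π / 2 ∧ crossLog θ = 0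

theorem exists_isCross : ∃ θ, IsCross θ := by
  have h1 : arcsin rho ≤ angA := by
    have := sin_angA_bounds.1
    rw [← arcsin_sin (by linarith [angA_pos, pi_pos]) angA_lt.le]
    exact monotone_arcsin (by linarith [rho_lt])
  have h0 : 0 < arcsin rho := arcsin_pos.2 rho_pos
  have hpos := crossLog_pos_of_small h0 (arcsin_le_pi_div_two _)
    (sin_arcsin (by linarith [rho_pos]) rho_lt_one.le).le
  have hc : ContinuousOn crossLog (Set.Icc (arcsin rho) angA) := fun x _ =>
    (hasDerivAt_crossLog x).continuousAt.continuousWithinAt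
  obtain ⟨θ, hθ, he⟩ := intermediate_value_Icc' h1 hc ⟨crossLog_angA.le, hpos.le⟩
  exact ⟨θ, h0.trans_le hθ.1, hθ.2.trans angA_lt.le, he⟩

theorem IsCross.eq {z w : ℝ} (hz : IsCross z) (hw : IsCross w) : z = w := by
  rcases lt_trichotomy z w with h | h | h
  · exact absurd hw.2.2 (crossLog_neg_of_lt hz.1 h hw.2.1 hz.2.2.le).ne
  · exact h
  · exact absurd hz.2.2 (crossLog_neg_of_lt hw.1 h hz.2.1 hw.2.2.le).ne

theorem IsCross.rho_lt_sin {θ : ℝ} (h : IsCross θ) : rho < sin θ := by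
  by_contra! hs
  exact (crossLog_pos_of_small h.1 h.2.1 hs).ne' h.2.2

theorem IsCross.lt_pi_div_two {θ : ℝ} (h : IsCross θ) : θ < π / 2 :=
  lt_of_le_of_ne h.2.1 fun e => crossLog_pi_div_two.ne (e ▸ h.2.2)

theorem pi_div_two_mul (x : ℝ) : π / 2 * (1 - gap x) = sin x := by
  have := pi_ne_zero
  rw [gap, rho]
  field_simp
  ring

theorem gap_arcsin' {y : ℝ} (h0 : 1 - rho ≤ y) (h1 : y ≤ 1) :
    gap (arcsin (π / 2 * (1 - y))) = y := by
  have hpi := pi_pos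
  have hr : π / 2 * rho = 1 := by rw [rho]; field_simp
  rw [gap, sin_arcsin (by nlinarith) (by nlinarith)]
  linear_combination (y - 1) * hr

theorem const_one : 4 / (π ^ 2 + 4) = rho ^ 2 / (1 + rho ^ 2) := by
  rw [rho]
  have := pi_ne_zero
  field_simp
  ring

theorem const_two : 4 * ((π ^ 2 - 2) / π ^ 4) = (1 - (1 - rho ^ 2) ^ 2) / 2 := by
  rw [rho]
  have := pi_ne_zero
  field_simp
  ring

theorem const_three : 2 * ((π - 1) / π ^ 2) = (1 - (1 - rho) ^ 2) / 2 := by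
  rw [rho]
  have := pi_ne_zero
  field_simp
  ring

/-- The left side of the equation for `κ` becomes `θ`, and the right side `(3/2) (2θ/3)`, because
`gap (2θ/3) ^ 3 = gap θ ^ 2`. -/
theorem IsCross.isKappa {θ : ℝ} (h : IsCross θ) : IsKappa ((1 - gap θ ^ 2) / 2) := by
  have hpi := pi_pos
  obtain ⟨h0, h1, he⟩ := id h
  rw [crossLog_eq_zero_iff] at he
  have hg := gap_pos θ
  have hr := rho_pos
  have hs := h.rho_lt_sin
  have e : 1 - 2 * ((1 - gap θ ^ 2) / 2) = gap θ ^ 2 := by ring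
  refine ⟨⟨?_, ?_⟩, ?_⟩
  · have : gap θ < 1 := by unfold gap; nlinarith
    nlinarith
  · rw [const_three]
    have : 1 - rho ≤ gap θ := by unfold gap; nlinarith [sin_le_one θ]
    nlinarith [rho_lt_one]
  · rw [e, sqrt_sq hg.le, ← he]
    have e2 : (gap (2 * θ / 3) ^ 3) ^ (1 / 3 : ℝ) = gap (2 * θ / 3) := by
      rw [← rpow_natCast, ← rpow_mul (gap_pos _).le]
      norm_num
    rw [e2, pi_div_two_mul, pi_div_two_mul, arcsin_sin (by linarith) h1,
      arcsin_sin (by linarith) (by linarith)]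
    ring

theorem IsKappa.exists_isCross {κ : ℝ} (h : IsKappa κ) :
    ∃ θ, IsCross θ ∧ κ = (1 - gap θ ^ 2) / 2 := by
  obtain ⟨⟨h0, h1⟩, he⟩ := h
  rw [const_three] at h1
  have hr := rho_pos
  have hr1 := rho_lt_one
  set u := 1 - 2 * κ with hu
  -- The upper bound on `κ` amounts to `√u ≥ 1 - ρ`, which keeps the arguments of `arcsin` at most
  -- `1`.
  have hu0 : (1 - rho) ^ 2 ≤ u := by linarith
  have hupos : 0 < u := by nlinarith
  have hsq : 1 - rho ≤ √u := le_sqrt_of_sq_le hu0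
  have hsq1 : √u < 1 := (sqrt_lt' one_pos).2 (by linarith)
  have hcu : √u ≤ u ^ (1 / 3 : ℝ) := by
    rw [sqrt_eq_rpow]
    exact rpow_le_rpow_of_exponent_ge hupos (by linarith) (by norm_num)
  have hcu1 : u ^ (1 / 3 : ℝ) ≤ 1 := rpow_le_one hupos.le (by linarith) (by norm_num)
  have g1 := gap_arcsin' hsq hsq1.le
  have g2 := gap_arcsin' (hsq.trans hcu) hcu1
  have e : arcsin (π / 2 * (1 - u ^ (1 / 3 : ℝ))) = 2 * arcsin (π / 2 * (1 - √u)) / 3 := by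
    linarith
  rw [e] at g2
  refine ⟨arcsin (π / 2 * (1 - √u)), ⟨arcsin_pos.2 (mul_pos (by positivity) (by linarith)),
    arcsin_le_pi_div_two _, ?_⟩, ?_⟩
  · rw [crossLog_eq_zero_iff, g2, g1, sq_sqrt hupos.le, ← rpow_natCast, ← rpow_mul hupos.le]
    norm_num
  · rw [g1, sq_sqrt hupos.le]
    linarith

theorem existsUnique_isKappa : ∃! κ : ℝ, IsKappa κ := by
  obtain ⟨θ, hθ⟩ := exists_isCross
  refine ⟨_, hθ.isKappa, fun κ hκ => ?_⟩
  obtain ⟨z, hz, e⟩ := hκ.exists_isCross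
  rw [e, hz.eq hθ]

theorem IsKappa.mem_Ioo {κ : ℝ} (h : IsKappa κ) :
    κ ∈ Set.Ioo (4 * ((π ^ 2 - 2) / π ^ 4)) (2 * ((π - 1) / π ^ 2)) := by
  obtain ⟨θ, hθ, rfl⟩ := h.exists_isCross
  have hr := rho_pos
  have hr1 := rho_lt_one
  have hs := hθ.rho_lt_sin
  have hg := gap_pos θ
  have hs1 : sin θ < 1 := by
    rw [← sin_pi_div_two]
    exact sin_lt_sin_of_lt_of_le_pi_div_two (by linarith [hθ.1, pi_pos]) le_rfl hθ.lt_pi_div_two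
  rw [const_two, const_three]
  constructor
  · have : gap θ < 1 - rho ^ 2 := by unfold gap; nlinarith
    nlinarith
  · have : 1 - rho < gap θ := by unfold gap; nlinarith
    nlinarith

/-! ### `N` as the inverse of `T` -/

theorem gap_anti {x y : ℝ} (h0 : 0 ≤ x) (h : x ≤ y) (h1 : y ≤ π / 2) : gap y ≤ gap x := by
  have := sin_le_sin_of_le_of_le_pi_div_two (by linarith [pi_pos]) h1 h
  unfold gap
  nlinarith [rho_pos]

theorem gap_strictAnti {x y : ℝ} (h0 : 0 ≤ x) (h : x < y) (h1 : y ≤ π / 2) : gap y < gap x := by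
  have := sin_lt_sin_of_lt_of_le_pi_div_two (by linarith [pi_pos]) h1 h
  unfold gap
  nlinarith [rho_pos]

theorem pairMin_of_rho_le {θ : ℝ} (h1 : rho ≤ sin θ) :
    pairMin θ = gap θ ^ 2 := by
  have hc : cos θ < 1 := by
    refine lt_of_le_of_ne (cos_le_one θ) fun h => ?_
    have := sin_sq_add_cos_sq θ
    rw [h] at this
    nlinarith [rho_pos]
  rw [pairMin, if_neg (by nlinarith [rho_pos])]
  split_ifs with h
  · have e : sin θ = rho := le_antisymm h h1
    rw [gap, cos_sq', e]
    ring
  · rfl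

theorem const_one_lt_two : 4 / (π ^ 2 + 4) < 4 * ((π ^ 2 - 2) / π ^ 4) := by
  rw [const_one, const_two, div_lt_iff₀ (by positivity)]
  nlinarith [rho_sq_lt, rho_sq_gt, mul_pos rho_pos rho_pos]

theorem optT_of_le_cross {c θ : ℝ} (hc : IsCross c) (h0 : 0 ≤ θ) (h : θ ≤ c) :
    optT θ = (1 - pairMin θ) / 2 := by
  have h1 : θ ≤ π / 2 := h.trans hc.2.1
  rw [optT_eq h0 h1, min_eq_left]
  refine (pairMin_le ⟨h0, h1⟩ ⟨h0, h1⟩ (by ring)).trans ?_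
  rw [← sq, ← crossLog_nonneg_iff]
  rcases h0.eq_or_lt with rfl | h0
  · simp
  rcases h.eq_or_lt with rfl | h
  · exact hc.2.2.ge
  by_contra! hn
  exact (crossLog_neg_of_lt h0 h hc.2.1 hn.le).ne hc.2.2

theorem optT_of_cross_lt {c θ : ℝ} (hc : IsCross c) (h : c < θ) (h1 : θ ≤ π / 2) :
    optT θ = (1 - gap (2 * θ / 3) ^ 3) / 2 := by
  have h0 : 0 ≤ θ := by linarith [hc.1]
  rw [optT_eq h0 h1, min_eq_right]
  have hneg := crossLog_neg_iff.1 (crossLog_neg_of_lt hc.1 h h1 hc.2.2.le)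
  refine hneg.le.trans ?_
  have hs : rho < sin θ := hc.rho_lt_sin.trans
    (sin_lt_sin_of_lt_of_le_pi_div_two (by linarith [hc.1, pi_pos]) h1 h)
  rw [pairMin, if_neg, if_neg hs.not_ge]
  intro h2
  nlinarith [cos_le_one θ, rho_pos]

/-- `T` has four regimes: merged pair, critical pair, equal pair, three equal angles. Each matches
one branch of `N`, which inverts it explicitly. -/
theorem estN_optT {κ θ : ℝ} (hκ : IsKappa κ) (h0 : 0 ≤ θ) (h1 : θ ≤ π / 2) :
    estN κ (optT θ) = θ := by
  have hpi := pi_pos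
  have hr := rho_pos
  have hr1 := rho_lt_one
  have hsqc := sin_sq_add_cos_sq θ
  have hs0 : 0 ≤ sin θ := sin_nonneg_of_nonneg_of_le_pi h0 (by linarith)
  have hc0 : 0 ≤ cos θ := cos_nonneg_of_mem_Icc ⟨by linarith, h1⟩
  have h12 := const_one_lt_two
  have hκ2 := hκ.mem_Ioo.1
  obtain ⟨c, hc, rfl⟩ := hκ.exists_isCross
  have hcs := hc.rho_lt_sin
  rcases le_or_gt θ c with h | h
  · rw [optT_of_le_cross hc h0 h]
    -- The case `sin θ = ρ` goes with the equal pair, since `N` has a strict bound at `4 (π² - 2) /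
    -- π⁴`.
    rcases lt_or_ge (sin θ) rho with hs | hs
    · by_cases ht : sin θ ≤ rho * cos θ
      · have hA := (sin_le_iff h0 h1).1 ht
        have e : (1 - pairMin θ) / 2 = sin (2 * θ) / π := by
          rw [pairMin, if_pos ht, gap, rho]
          ring
        have hle : sin (2 * θ) ≤ sin angA :=
          sin_le_sin_of_le_of_le_pi_div_two (by linarith) (angA_lt.le) (by linarith)
        rw [e, estN, if_pos]
        · have e2 : π * (sin (2 * θ) / π) = sin (2 * θ) := by field_simp
          rw [e2, arcsin_sin (by linarith) (by linarith [angA_lt])]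
          ring
        · rw [const_one]
          rw [sin_angA] at hle
          calc sin (2 * θ) / π ≤ 2 * rho / (1 + rho ^ 2) / π := by gcongr
            _ = rho ^ 2 / (1 + rho ^ 2) := by
              rw [rho]
              field_simp
      · have e : pairMin θ = (1 - rho ^ 2) * cos θ ^ 2 := by
          rw [pairMin, if_neg ht, if_pos hs.le]
        rw [e, estN, if_neg, if_pos]
        · have hne : (1 - rho ^ 2) ≠ 0 := by nlinarith
          have hpi4 : π ^ 2 - 4 ≠ 0 := by nlinarith [pi_gt_three]
          have e2 : (2 * π ^ 2 * ((1 - (1 - rho ^ 2) * cos θ ^ 2) / 2) - 4) / (π ^ 2 - 4) =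
              sin θ ^ 2 := by
            rw [cos_sq', rho]
            field_simp
            ring
          rw [e2, sqrt_sq hs0, arcsin_sin (by linarith) h1]
        · rw [const_two]
          have : 1 - rho ^ 2 < cos θ ^ 2 := by nlinarith
          have := mul_lt_mul_of_pos_left this (sub_pos.2 rho_sq_lt_one)
          nlinarith
        · rw [const_one, not_le, div_lt_iff₀ (by positivity)]
          rw [not_le] at ht
          have : (rho * cos θ) ^ 2 < sin θ ^ 2 := by gcongr
          have hcc : cos θ ^ 2 * (1 + rho ^ 2) < 1 := by nlinarith
          have := mul_pos (sub_pos.2 rho_sq_lt_one) (sub_pos.2 hcc)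
          nlinarith
    · rw [pairMin_of_rho_le hs]
      have hx : 4 * ((π ^ 2 - 2) / π ^ 4) ≤ (1 - gap θ ^ 2) / 2 := by
        rw [const_two]
        have h3 : gap θ ≤ 1 - rho ^ 2 := by unfold gap; nlinarith
        nlinarith [gap_pos θ]
      rw [estN, if_neg (by linarith), if_neg (by linarith), if_pos]
      · have e : 1 - 2 * ((1 - gap θ ^ 2) / 2) = gap θ ^ 2 := by ring
        rw [e, sqrt_sq (gap_pos θ).le, pi_div_two_mul, arcsin_sin (by linarith) h1]
      · have := gap_anti h0 h hc.2.1
        nlinarith [gap_pos c]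
  · rw [optT_of_cross_lt hc h h1]
    have hx : (1 - gap c ^ 2) / 2 < (1 - gap (2 * θ / 3) ^ 3) / 2 := by
      rw [← crossLog_eq_zero_iff.1 hc.2.2]
      have hlt := gap_strictAnti (x := 2 * c / 3) (y := 2 * θ / 3) (by linarith [hc.1])
        (by linarith) (by linarith)
      have : gap (2 * θ / 3) ^ 3 < gap (2 * c / 3) ^ 3 := by
        gcongr
        exact (gap_pos _).le
      linarith
    rw [estN, if_neg (by linarith), if_neg (by linarith), if_neg hx.not_ge]
    have e : 1 - 2 * ((1 - gap (2 * θ / 3) ^ 3) / 2) = gap (2 * θ / 3) ^ 3 := by ring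
    have e2 : (gap (2 * θ / 3) ^ 3) ^ (1 / 3 : ℝ) = gap (2 * θ / 3) := by
      rw [← rpow_natCast, ← rpow_mul (gap_pos _).le]
      norm_num
    rw [e, e2, pi_div_two_mul, arcsin_sin (by linarith) (by linarith)]
    ring

theorem optT_zero : optT 0 = 0 := by
  rw [optT_eq le_rfl (by positivity), pairMin]
  simp [rho_pos.le]

theorem optT_pi_div_two : optT (π / 2) = cCrit := by
  obtain ⟨c, hc⟩ := exists_isCross
  rw [optT_of_cross_lt hc hc.lt_pi_div_two le_rfl, cCrit]
  have e : 2 * (π / 2) / 3 = π / 3 := by ring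
  rw [e, gap, sin_pi_div_three, rho]
  ring

theorem continuousOn_optT : ContinuousOn optT (Set.Icc 0 (π / 2)) := by
  have hc : Continuous fun θ => (1 - min (pairMin θ) (gap (2 * θ / 3) ^ 3)) / 2 := by
    have := continuous_gap
    have := continuous_pairMin
    fun_prop
  exact hc.continuousOn.congr fun θ h => optT_eq h.1 h.2

theorem cCrit_bounds : 0 ≤ cCrit ∧ cCrit < 1 / 2 := by
  rw [← optT_pi_div_two, optT_eq (by positivity) le_rfl]
  obtain ⟨x, -, y, -, -, h⟩ := exists_pairMin (θ := π / 2) (by positivity) le_rfl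
  have h1 : 0 < pairMin (π / 2) := h ▸ mul_pos (gap_pos x) (gap_pos y)
  have h2 := pow_pos (gap_pos (2 * (π / 2) / 3)) 3
  have h3 := lt_min h1 h2
  have h4 : gap (2 * (π / 2) / 3) ≤ 1 := by
    rw [← gap_zero]
    exact gap_anti le_rfl (by positivity) (by linarith [pi_pos])
  have h5 := (min_le_right (pairMin (π / 2)) (gap (2 * (π / 2) / 3) ^ 3)).trans
    (pow_le_one₀ (gap_pos _).le h4)
  constructor <;> linarith

/-- The left inverse `estN` makes `T` injective; a continuous injective function on an interval with
ordered end values is strictly increasing. -/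
theorem strictMonoOn_optT : StrictMonoOn optT (Set.Icc 0 (π / 2)) := by
  obtain ⟨κ, hκ, -⟩ := existsUnique_isKappa
  refine continuousOn_optT.strictMonoOn_of_injOn_Icc (by positivity) ?_ ?_
  · rw [optT_zero, optT_pi_div_two]
    exact cCrit_bounds.1
  · exact Set.LeftInvOn.injOn (f₁' := estN κ) fun θ h => estN_optT hκ h.1 h.2

theorem image_optT : optT '' Set.Icc 0 (π / 2) = Set.Icc 0 cCrit := by
  have hpi : (0 : ℝ) ≤ π / 2 := by positivity
  apply Set.Subset.antisymm
  · rintro _ ⟨θ, h, rfl⟩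
    rw [← optT_zero, ← optT_pi_div_two]
    exact ⟨strictMonoOn_optT.monotoneOn ⟨le_rfl, hpi⟩ h h.1,
      strictMonoOn_optT.monotoneOn h ⟨hpi, le_rfl⟩ h.2⟩
  · have := intermediate_value_Icc hpi continuousOn_optT
    rwa [optT_zero, optT_pi_div_two] at this

theorem mapsTo_optT : Set.MapsTo optT (Set.Icc 0 (π / 2)) (Set.Icc 0 cCrit) :=
  Set.mapsTo_iff_image_subset.2 image_optT.le

theorem mapsTo_estN {κ : ℝ} (hκ : IsKappa κ) :
    Set.MapsTo (estN κ) (Set.Icc 0 cCrit) (Set.Icc 0 (π / 2)) := by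
  intro x hx
  rw [← image_optT] at hx
  obtain ⟨θ, h, rfl⟩ := hx
  rwa [estN_optT hκ h.1 h.2]

theorem invOn_optT {κ : ℝ} (hκ : IsKappa κ) :
    Set.InvOn optT (estN κ) (Set.Icc 0 cCrit) (Set.Icc 0 (π / 2)) := by
  refine ⟨fun x hx => ?_, fun θ h => estN_optT hκ h.1 h.2⟩
  rw [← image_optT] at hx
  obtain ⟨θ, h, rfl⟩ := hx
  rw [estN_optT hκ h.1 h.2]

theorem strictMonoOn_estN {κ : ℝ} (hκ : IsKappa κ) :
    StrictMonoOn (estN κ) (Set.Icc 0 cCrit) := by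
  intro x hx y hy hxy
  rw [← image_optT] at hx hy
  obtain ⟨θ, h, rfl⟩ := hx
  obtain ⟨η, h', rfl⟩ := hy
  rw [estN_optT hκ h.1 h.2, estN_optT hκ h'.1 h'.2]
  exact (strictMonoOn_optT.lt_iff_lt h h').1 hxy

/-! ### Comparison with `M_*` -/

theorem pi_sq_gt : 9 < π ^ 2 := by nlinarith [pi_gt_three]

theorem sin_angA' : sin angA = 4 * π / (π ^ 2 + 4) := by
  rw [sin_angA, rho]
  field_simp
  ring

theorem cos_angA' : cos angA = (π ^ 2 - 4) / (π ^ 2 + 4) := by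
  rw [cos_angA, rho]
  field_simp
  ring

theorem gap_angA : gap angA = (π ^ 2 - 4) / (π ^ 2 + 4) := by
  rw [gap, sin_angA', rho]
  field_simp
  ring

theorem arcsin_const : arcsin (4 * π / (π ^ 2 + 4)) = angA := by
  rw [← sin_angA', arcsin_sin (by linarith [angA_pos, pi_pos]) angA_lt.le]

theorem angA_mem : angA ∈ Set.Icc 0 (π / 2) := ⟨angA_pos.le, angA_lt.le⟩

/-- If `(angA, α)` were optimal it would be equal or critical, but the critical partner of `angA` is
`0`. -/
theorem exists_better_pair {α : ℝ} (h0 : 0 < α) (h : α < angA) :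
    ∃ u ∈ Set.Icc 0 (π / 2), ∃ v ∈ Set.Icc 0 (π / 2), u + v = angA + α ∧
      gap u * gap v < gap angA * gap α := by
  have hα : α ∈ Set.Icc 0 (π / 2) := ⟨h0.le, h.le.trans angA_lt.le⟩
  by_contra! hmin
  rcases eq_or_crit angA_mem hα hmin
    (rho_mul_cos_le_sin (by linarith) (by linarith [angA_lt])) with ⟨he, -⟩ | ⟨-, hc⟩
  · exact h.ne he.symm
  · refine h0.ne' (crit_unique angA_mem hα ⟨le_rfl, by positivity⟩ hc ?_)
    rw [add_zero, sub_zero, sin_angA_half]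

theorem lt_optT_pair {α : ℝ} (h0 : 0 < α) (h : α ≤ angA) :
    (1 - gap angA * gap α) / 2 < optT ((angA + α) / 2) := by
  have hA := angA_lt
  -- For `α = angA` three equal angles beat the pair; otherwise a better pair exists.
  rcases h.eq_or_lt with rfl | h
  · have hm : 2 * angA / 3 ∈ Set.Icc 0 (π / 2) := ⟨by linarith, by linarith⟩
    have := triple_le_optT (θ := (angA + angA) / 2) (by linarith) (by linarith) hm hm hm (by ring)
    have := gap_two_thirds_angA
    nlinarith
  · obtain ⟨u, hu, v, hv, huv, hlt⟩ := exists_better_pair h0 h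
    have := triple_le_optT (θ := (angA + α) / 2) (by linarith) (by linarith) hu hv
      (z := 0) ⟨le_rfl, by positivity⟩ (by linarith)
    rw [gap_zero, mul_one] at this
    linarith

theorem lt_optT_triple {α : ℝ} (h0 : 0 < α) (h : 2 * angA + α ≤ π) :
    (1 - gap angA * gap angA * gap α) / 2 < optT ((2 * angA + α) / 2) := by
  have hA := angA_pos
  -- Here `α ≤ π - 2 angA < angA`. One `angA` stays and the pair `(angA, α)` is improved.
  obtain ⟨u, hu, v, hv, huv, hlt⟩ := exists_better_pair h0 (by linarith [angA_gt])
  have := triple_le_optT (θ := (2 * angA + α) / 2) (by linarith) (by linarith) hu hv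
    angA_mem (by linarith)
  nlinarith [gap_pos angA]

theorem MStar_middle {x : ℝ} (h1 : 4 / (π ^ 2 + 4) < x) (h2 : x ≤ 8 * π ^ 2 / (π ^ 2 + 4) ^ 2) :
    ∃ α, 0 < α ∧ α ≤ angA ∧ MStar x = (angA + α) / 2 ∧ x = (1 - gap angA * gap α) / 2 := by
  have hpi := pi_pos
  have hP := pi_sq_gt
  have hne : π ^ 2 - 4 ≠ 0 := by linarith
  refine ⟨arcsin (π * (((π ^ 2 + 4) * x - 4) / (π ^ 2 - 4))), ?_, ?_, ?_, ?_⟩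
  · rw [div_lt_iff₀ (by positivity)] at h1
    exact arcsin_pos.2 (mul_pos hpi (div_pos (by linarith) (by linarith)))
  · rw [← arcsin_const]
    refine monotone_arcsin ?_
    rw [mul_comm (4 : ℝ), mul_div_assoc]
    refine mul_le_mul_of_nonneg_left ?_ hpi.le
    rw [le_div_iff₀ (by positivity)] at h2
    rw [div_le_div_iff₀ (by linarith) (by positivity)]
    linarith
  · rw [MStar, if_neg h1.not_ge, if_pos h2, arcsin_const]
    ring
  · rw [div_lt_iff₀ (by positivity)] at h1
    rw [le_div_iff₀ (by positivity)] at h2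
    rw [gap_arcsin, gap_angA]
    · field_simp
      ring
    · exact div_nonneg (by linarith) (by linarith)
    · have h3 : ((π ^ 2 + 4) * x - 4) / (π ^ 2 - 4) ≤ 4 / (π ^ 2 + 4) := by
        rw [div_le_div_iff₀ (by linarith) (by positivity)]
        linarith
      refine h3.trans ?_
      rw [div_le_div_iff₀ (by positivity) hpi]
      nlinarith [sq_nonneg (π - 2)]

theorem MStar_last {x : ℝ} (h1 : 8 * π ^ 2 / (π ^ 2 + 4) ^ 2 < x) (h2 : x ≤ cStar) :
    ∃ α, 0 < α ∧ 2 * angA + α ≤ π ∧ MStar x = (2 * angA + α) / 2 ∧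
      x = (1 - gap angA * gap angA * gap α) / 2 := by
  have hpi := pi_pos
  have hP := pi_sq_gt
  have hne : π ^ 2 - 4 ≠ 0 := by linarith
  have h0 : ¬ x ≤ 4 / (π ^ 2 + 4) := by
    refine not_le.2 (lt_trans ?_ h1)
    rw [div_lt_div_iff₀ (by positivity) (by positivity)]
    nlinarith
  have h1' := h1
  rw [div_lt_iff₀ (by positivity)] at h1
  have hnn : 0 < ((π ^ 2 + 4) ^ 2 * x - 8 * π ^ 2) / (π ^ 2 - 4) ^ 2 :=
    div_pos (by linarith) (by positivity)
  -- The constant `c_*` is the value of `x` at which `α = π - 2 angA`, that is, at which `M_*`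
  -- reaches `π/2`.
  have hle : ((π ^ 2 + 4) ^ 2 * x - 8 * π ^ 2) / (π ^ 2 - 4) ^ 2 ≤ sin (π - 2 * angA) / π := by
    have e : sin (π - 2 * angA) / π = 8 * (π ^ 2 - 4) / (π ^ 2 + 4) ^ 2 := by
      rw [sin_pi_sub, sin_two_mul, sin_angA', cos_angA']
      field_simp
      ring
    rw [cStar, ← mul_div_assoc, le_div_iff₀ (by positivity)] at h2
    rw [e, div_le_div_iff₀ (by positivity) (by positivity)]
    linarith
  refine ⟨arcsin (π * (((π ^ 2 + 4) ^ 2 * x - 8 * π ^ 2) / (π ^ 2 - 4) ^ 2)),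
    arcsin_pos.2 (mul_pos hpi hnn), ?_, ?_, ?_⟩
  · rw [le_div_iff₀' hpi] at hle
    have := monotone_arcsin hle
    rw [arcsin_sin (by linarith [angA_lt]) (by linarith [angA_gt])] at this
    linarith
  · rw [MStar, if_neg h0, if_neg h1'.not_ge, arcsin_const]
    ring
  · rw [gap_arcsin hnn.le (hle.trans (div_le_div_of_nonneg_right (sin_le_one _) hpi.le)), gap_angA]
    field_simp
    ring

theorem lt_optT_MStar {x : ℝ} (h1 : 4 / (π ^ 2 + 4) < x) (h2 : x ≤ cStar) :
    MStar x ∈ Set.Icc 0 (π / 2) ∧ x < optT (MStar x) := by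
  have hA := angA_pos
  have hA' := angA_lt
  rcases le_or_gt x (8 * π ^ 2 / (π ^ 2 + 4) ^ 2) with h | h
  · obtain ⟨α, h0, hα, hM, hx⟩ := MStar_middle h1 h
    have := lt_optT_pair h0 hα
    rw [hM]
    exact ⟨⟨by linarith, by linarith⟩, by linarith⟩
  · obtain ⟨α, h0, hα, hM, hx⟩ := MStar_last h h2
    have := lt_optT_triple h0 hα
    rw [hM]
    exact ⟨⟨by linarith, by linarith⟩, by linarith⟩

theorem const_one_lt_cStar : 4 / (π ^ 2 + 4) < cStar := by
  have hP := pi_sq_gt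
  rw [cStar, ← mul_div_assoc, div_lt_div_iff₀ (by positivity) (by positivity)]
  have e4 : π ^ 4 = (π ^ 2) ^ 2 := by ring
  have e6 : π ^ 6 = (π ^ 2) ^ 3 := by ring
  rw [e4, e6]
  generalize π ^ 2 = P at *
  have h : (P + 4) ^ 3 < 4 * (P ^ 3 - 2 * P ^ 2 + 32 * P - 32) := by
    nlinarith [mul_nonneg (by linarith : 0 ≤ P - 9) (sq_nonneg P)]
  have := mul_lt_mul_of_pos_right h (by linarith : 0 < P + 4)
  linarith

theorem cStar_lt_cCrit : cStar < cCrit := by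
  obtain ⟨hM, hlt⟩ := lt_optT_MStar const_one_lt_cStar le_rfl
  exact hlt.trans_le (mapsTo_optT hM).2

theorem mapsTo_MStar : Set.MapsTo MStar (Set.Icc 0 cStar) (Set.Icc 0 (π / 2)) := by
  intro x hx
  rcases le_or_gt x (4 / (π ^ 2 + 4)) with h | h
  · rw [MStar, if_pos h]
    have h0 := arcsin_nonneg.2 (mul_nonneg pi_pos.le hx.1)
    have h1 := arcsin_le_pi_div_two (π * x)
    constructor <;> linarith
  · exact (lt_optT_MStar h hx.2).1

end SubspacePerturbation

theorem mainTheorem4 :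
    -- the switching point of `N` exists and is unique
    (∃! κ : ℝ, SubspacePerturbation.IsKappa κ) ∧
    -- `c_*` lies in `(0, 1/2)`, and `M_*` maps `[0, c_*]` into `[0, π/2]`
    SubspacePerturbation.cStar ∈ Set.Ioo (0 : ℝ) (1 / 2) ∧
    Set.MapsTo SubspacePerturbation.MStar
      (Set.Icc 0 SubspacePerturbation.cStar) (Set.Icc 0 (Real.pi / 2)) ∧
    SubspacePerturbation.cStar < SubspacePerturbation.cCrit ∧
    ∀ κ : ℝ, SubspacePerturbation.IsKappa κ →
      κ ∈ Set.Ioo (4 * ((Real.pi ^ 2 - 2) / Real.pi ^ 4)) (2 * ((Real.pi - 1) / Real.pi ^ 2)) ∧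
      -- `N` is strictly increasing on `[0, c_crit]` and is the inverse of `T` on `[0, π/2]`
      StrictMonoOn (SubspacePerturbation.estN κ) (Set.Icc 0 SubspacePerturbation.cCrit) ∧
      Set.MapsTo (SubspacePerturbation.estN κ)
        (Set.Icc 0 SubspacePerturbation.cCrit) (Set.Icc 0 (Real.pi / 2)) ∧
      Set.MapsTo SubspacePerturbation.optT
        (Set.Icc 0 (Real.pi / 2)) (Set.Icc 0 SubspacePerturbation.cCrit) ∧
      Set.InvOn SubspacePerturbation.optT (SubspacePerturbation.estN κ)
        (Set.Icc 0 SubspacePerturbation.cCrit) (Set.Icc 0 (Real.pi / 2)) ∧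
      -- comparison of `N` with `M_*`
      (∀ x : ℝ, 0 ≤ x → x ≤ 4 / (Real.pi ^ 2 + 4) →
        SubspacePerturbation.estN κ x = SubspacePerturbation.MStar x) ∧
      ∀ x : ℝ, 4 / (Real.pi ^ 2 + 4) < x → x ≤ SubspacePerturbation.cStar →
        SubspacePerturbation.estN κ x < SubspacePerturbation.MStar x ∧
        x < SubspacePerturbation.optT (SubspacePerturbation.MStar x) ∧
        SubspacePerturbation.optT (SubspacePerturbation.MStar x) ≤ SubspacePerturbation.cCrit ∧
        SubspacePerturbation.estN κ
            (SubspacePerturbation.optT (SubspacePerturbation.MStar x)) =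
          SubspacePerturbation.MStar x := by
  have hcrit := SubspacePerturbation.cStar_lt_cCrit
  have hpos : 0 < SubspacePerturbation.cStar :=
    lt_trans (by positivity) SubspacePerturbation.const_one_lt_cStar
  refine ⟨SubspacePerturbation.existsUnique_isKappa,
    ⟨hpos, hcrit.trans SubspacePerturbation.cCrit_bounds.2⟩,
    SubspacePerturbation.mapsTo_MStar, hcrit,
    fun κ hκ => ⟨hκ.mem_Ioo, SubspacePerturbation.strictMonoOn_estN hκ,
      SubspacePerturbation.mapsTo_estN hκ, SubspacePerturbation.mapsTo_optT,
      SubspacePerturbation.invOn_optT hκ,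
      fun x _ h => by rw [SubspacePerturbation.estN, if_pos h, SubspacePerturbation.MStar, if_pos h],
      fun x h1 h2 => ?_⟩⟩
  obtain ⟨hM, hlt⟩ := SubspacePerturbation.lt_optT_MStar h1 h2
  have hT := SubspacePerturbation.mapsTo_optT hM
  have hN := SubspacePerturbation.estN_optT hκ hM.1 hM.2
  have hx0 : 0 ≤ x := (lt_trans (by positivity) h1).le
  refine ⟨?_, hlt, hT.2, hN⟩
  rw [← hN]
  exact SubspacePerturbation.strictMonoOn_estN hκ ⟨hx0, h2.trans hcrit.le⟩ hT hlt
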